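/- Let $g\ge 1$, let $p$ be a prime, let $k'$ be a finite field of characteristic $p$ with $q'$ elements, and let ${\bf w}\ge 0$ be an integer. Let $\hat G=GSpin_{2g+1}$ be the even Clifford group of the quadratic form $\sum_{i=1}^g 2x_ix_i'+x_0^2$, with standard split maximal torus $\hat T$, character lattice $X=X^*(\hat T)$, multiplier (spinor norm) $\nu$, and roots $\pm\varepsilon_i$, $\pm\varepsilon_i\pm\varepsilon_j$ ($i\neq j$). Let $\hat\varpi=\frac12(\varepsilon_1+\dots+\varepsilon_g+\nu)\in X$ be the minuscule weight, i.e. the highest weight of the spin representation (on $\bigwedge\langle e_1,\dots,e_g\rangle$). Let $X'\subset X$ be the span of the fundamental weights $\hat\varpi_i=\varepsilon_1+\dots+\varepsilon_i$ ($i<g$) and $\hat\varpi_g=\hat\varpi$, so that $X=X'\oplus\mathbb Z\nu$. Let $W'=\{\pm1\}^g$ be the group of sign changes in the Weyl group: $w_B$ ($B\subset\{1,\dots,g\}$) maps $\varepsilon_i$ to $-\varepsilon_i$ for $i\in B$ and fixes the other $\varepsilon_j$ and $\nu$. Let $H^0\subset\hat G$ be a connected split reductive subgroup of semisimple rank $g$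 containing $\hat T$ and normalized by $W'$; thus $H^0$ is generated by $\hat T$ and the root subgroups $U_\alpha$, $\alpha\in\Phi$, for a closed symmetric $W'$-stable set $\Phi$ of roots of $\hat G$ of rank $g$. Let $\Delta$ be any basis of the root system $\Phi$; highest weights for $H^0$ are taken with respect to the Borel subgroup of $H^0$ defined by $\Delta$. Let $\hat T(k')_\nu$ be the group of all $t\in\hat T(k')$ such that $\nu(t)$ is a ${\bf w}$-th power in $k'^\times$, and write $\bar\chi$ for the restriction of $\chi\in X$ to $\hat T(k')_\nu$. Put $e=(q'-1)/\gcd({\bf w},q'-1)$. A weight $\mu\in X$ is called $q'$-reduced if $\mu=v+a\nu$ with $v\in X'$, $0\le a\le e-1$ and $0\le\langle v,\beta^\vee\rangle\le q'-1$ for all $\beta\in\Delta$. 1. Suppose $p>5$. Let $\mu$ be $q'$-reduced and let $W(\mu)$ be a simple $H^0_{k'}$-module (a finite-dimensional rational representation over $k'$) with highest weight $\mu$. If $\bar\mu=\bar{\hat\varpi}$, and if for every weight $\chi$ of $W(\mu)$ there is a weight $\eta$ of the spin representation of $\hat G$ with $\bar\chi=\bar\eta$, then $\mu=\hat\varpi$.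 2. For $p=5$ the assertion of 1 is false. Let $g=2$, $\Phi=\{\pm\varepsilon_1\pm\varepsilon_2\}$ (so that $H^0\cap Spin_5\cong SL_2\times SL_2$), $q'=5$ and ${\bf w}$ even. For the basis $\Delta=\{-\varepsilon_1-\varepsilon_2,\ \varepsilon_1-\varepsilon_2\}$, the weight $\mu=-3\hat\varpi\ne\hat\varpi$ is $q'$-reduced, and there is a simple $H^0_{k'}$-module with highest weight $\mu$ that satisfies all the hypotheses of 1 other than $p>5$. 3. With $g,\Phi,q'$ as in 2 and $4\mid{\bf w}$ (so that $\nu$ is trivial on $\hat T(k')_\nu$), take the standard basis $\Delta=\{\varepsilon_1+\varepsilon_2,\ \varepsilon_1-\varepsilon_2\}$. Then $\mu=3\hat\varpi$ is $q'$-reduced and not in $W'\hat\varpi$, but $\bar\mu=\overline{w_{\{1,2\}}\hat\varpi}$, and there is a simple $H^0_{k'}$-module with highest weight $\mu$ each of whose weights has the same restriction to $\hat T(k')_\nu$ as some weight of the spin representation. -/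

import Mathlib

namespace SpinLemma

noncomputable section

/-! ### The group `GSpin_{2g+1}` inside the Clifford algebra -/

/-- Indices of the basis `e_1, …, e_g` (`inl (inl i)`), `e'_1, …, e'_g` (`inl (inr i)`), `e_0`
(`inr ()`) of the quadratic space. -/
abbrev Idx (g : ℕ) : Type := (Fin g ⊕ Fin g) ⊕ Unit

/-- The quadratic form `q(x) = ∑ 2 x_i x'_i + x_0²` in `2g + 1` variables. -/
def quadForm (g : ℕ) (K : Type*) [Field K] : QuadraticForm K (Idx g → K) :=
  (∑ i : Fin g, (2 : K) • QuadraticMap.linMulLin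
      (LinearMap.proj (Sum.inl (Sum.inl i)) : (Idx g → K) →ₗ[K] K)
      (LinearMap.proj (Sum.inl (Sum.inr i)) : (Idx g → K) →ₗ[K] K)) +
    QuadraticMap.linMulLin
      (LinearMap.proj (Sum.inr ()) : (Idx g → K) →ₗ[K] K)
      (LinearMap.proj (Sum.inr ()) : (Idx g → K) →ₗ[K] K)

theorem quadForm_apply (g : ℕ) (K : Type*) [Field K] (x : Idx g → K) :
    quadForm g K x =
      ∑ i : Fin g, 2 * (x (Sum.inl (Sum.inl i)) * x (Sum.inl (Sum.inr i)))
        + x (Sum.inr ()) * x (Sum.inr ()) := by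
  simp [quadForm]

/-- The Clifford algebra of `quadForm`. -/
abbrev Cl (g : ℕ) (K : Type*) [Field K] : Type _ := CliffordAlgebra (quadForm g K)

/-- The basis vectors, as elements of the Clifford algebra. -/
def bvec (g : ℕ) (K : Type*) [Field K] (j : Idx g) : Cl g K :=
  CliffordAlgebra.ι (quadForm g K) (Pi.single j 1)

/-- `u` is even and conjugation by `u` maps the quadratic space into itself. -/
def IsEvenClifford {g : ℕ} {K : Type*} [Field K] (u : (Cl g K)ˣ) : Prop :=
  (u : Cl g K) ∈ CliffordAlgebra.evenOdd (quadForm g K) 0 ∧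
    ∀ x : Idx g → K, ∃ y : Idx g → K,
      (u : Cl g K) * CliffordAlgebra.ι (quadForm g K) x * ((u⁻¹ : (Cl g K)ˣ) : Cl g K) =
        CliffordAlgebra.ι (quadForm g K) y

theorem IsEvenClifford.mul {g : ℕ} {K : Type*} [Field K] {u v : (Cl g K)ˣ}
    (hu : IsEvenClifford u) (hv : IsEvenClifford v) : IsEvenClifford (u * v) := by
  refine ⟨?_, fun x => ?_⟩
  · have := SetLike.GradedMul.mul_mem (A := CliffordAlgebra.evenOdd (quadForm g K)) hu.1 hv.1
    simpa using this
  · obtain ⟨y, hy⟩ := hv.2 x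
    obtain ⟨z, hz⟩ := hu.2 y
    refine ⟨z, ?_⟩
    rw [← hz, ← hy]
    simp [mul_assoc]

/-- The group `GSpin_{2g+1}(K)` (the even Clifford group). -/
def GSpin (g : ℕ) (K : Type*) [Field K] : Subgroup (Cl g K)ˣ where
  carrier := {u | IsEvenClifford u ∧ IsEvenClifford u⁻¹}
  mul_mem' := by
    rintro u v ⟨hu, hu'⟩ ⟨hv, hv'⟩
    exact ⟨hu.mul hv, by rw [mul_inv_rev]; exact hv'.mul hu'⟩
  one_mem' := by
    have h : IsEvenClifford (1 : (Cl g K)ˣ) :=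
      ⟨by
        rw [Units.val_one]
        exact SetLike.GradedOne.one_mem (A := CliffordAlgebra.evenOdd (quadForm g K)),
        fun x => ⟨x, by simp⟩⟩
    exact ⟨h, by simpa using h⟩
  inv_mem' := by
    rintro u ⟨hu, hu'⟩
    exact ⟨hu', by simpa using hu⟩

/-! ### The maximal torus, its characters, and the roots -/

theorem bvec_sq_left (g : ℕ) (K : Type*) [Field K] (i : Fin g) :
    bvec g K (Sum.inl (Sum.inl i)) * bvec g K (Sum.inl (Sum.inl i)) = 0 := by
  rw [bvec, CliffordAlgebra.ι_sq_scalar, quadForm_apply]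
  simp

theorem bvec_sq_right (g : ℕ) (K : Type*) [Field K] (i : Fin g) :
    bvec g K (Sum.inl (Sum.inr i)) * bvec g K (Sum.inl (Sum.inr i)) = 0 := by
  rw [bvec, CliffordAlgebra.ι_sq_scalar, quadForm_apply]
  simp

theorem polar_single (g : ℕ) (K : Type*) [Field K] (i : Fin g) :
    QuadraticMap.polar (quadForm g K) (Pi.single (Sum.inl (Sum.inl i)) 1)
      (Pi.single (Sum.inl (Sum.inr i)) 1) = 2 := by
  simp [QuadraticMap.polar, quadForm_apply, Pi.single_apply]

theorem bvec_idem (g : ℕ) (K : Type*) [Field K] (i : Fin g) :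
    (bvec g K (Sum.inl (Sum.inl i)) * bvec g K (Sum.inl (Sum.inr i))) *
      (bvec g K (Sum.inl (Sum.inl i)) * bvec g K (Sum.inl (Sum.inr i))) =
    (2 : K) • (bvec g K (Sum.inl (Sum.inl i)) * bvec g K (Sum.inl (Sum.inr i))) := by
  have h := CliffordAlgebra.ι_mul_ι_add_swap (Q := quadForm g K)
    (Pi.single (Sum.inl (Sum.inl i)) 1) (Pi.single (Sum.inl (Sum.inr i)) 1)
  rw [polar_single] at h
  have h0 := bvec_sq_left g K i
  have h1 := bvec_sq_right g K i
  change bvec g K (Sum.inl (Sum.inl i)) * bvec g K (Sum.inl (Sum.inr i)) +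
    bvec g K (Sum.inl (Sum.inr i)) * bvec g K (Sum.inl (Sum.inl i)) = _ at h
  generalize bvec g K (Sum.inl (Sum.inl i)) = e at *
  generalize bvec g K (Sum.inl (Sum.inr i)) = f at *
  have hfe : f * e = algebraMap K _ 2 - e * f := by rw [← h]; abel
  calc e * f * (e * f) = e * (f * e) * f := by simp only [mul_assoc]
    _ = e * algebraMap K _ 2 * f - (e * e) * (f * f) := by
        rw [hfe]; simp only [mul_sub, sub_mul, mul_assoc]
    _ = _ := by
        rw [h0, zero_mul, sub_zero, ← Algebra.commutes, mul_assoc, Algebra.smul_def]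

theorem torusFactor_mul (g : ℕ) (K : Type*) [Field K] (i : Fin g) (a b : K) (hab : a * b = 1) :
    (1 + ((a - 1) / 2) • (bvec g K (Sum.inl (Sum.inl i)) * bvec g K (Sum.inl (Sum.inr i)))) *
    (1 + ((b - 1) / 2) • (bvec g K (Sum.inl (Sum.inl i)) * bvec g K (Sum.inl (Sum.inr i)))) =
      1 := by
  have h := bvec_idem g K i
  generalize bvec g K (Sum.inl (Sum.inl i)) * bvec g K (Sum.inl (Sum.inr i)) = E at *
  simp only [mul_add, add_mul, mul_one, one_mul, smul_mul_smul_comm, h, smul_smul]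
  rw [add_assoc, ← add_smul, ← add_smul]
  have : (a - 1) / 2 + ((b - 1) / 2 + (a - 1) / 2 * ((b - 1) / 2) * 2) = 0 := by
    by_cases h2 : (2 : K) = 0
    · simp [h2]
    · field_simp
      linear_combination hab
  rw [this]; simp

/-- The one-parameter torus `1 + (a - 1) e_i e'_i / 2`; it multiplies `e_i` by `a`, `e'_i` by
`a⁻¹` and fixes the other basis vectors. -/
def torusFactor (g : ℕ) (K : Type*) [Field K] (i : Fin g) (a : Kˣ) : (Cl g K)ˣ where
  val := 1 + (((a : K) - 1) / 2) •
    (bvec g K (Sum.inl (Sum.inl i)) * bvec g K (Sum.inl (Sum.inr i)))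
  inv := 1 + ((((a⁻¹ : Kˣ) : K) - 1) / 2) •
    (bvec g K (Sum.inl (Sum.inl i)) * bvec g K (Sum.inl (Sum.inr i)))
  val_inv := torusFactor_mul g K i _ _ (by simp)
  inv_val := torusFactor_mul g K i _ _ (by simp)

/-- Coordinates `(a_1, …, a_g; z)` on the points of the maximal torus. -/
abbrev TorusPt (g : ℕ) (K : Type*) [Field K] : Type _ := (Fin g → Kˣ) × Kˣ

/-- The element `z ∏ (1 + (a_i - 1) e_i e'_i / 2)` of the maximal torus of `GSpin_{2g+1}`. -/
def torusElt {g : ℕ} {K : Type*} [Field K] (t : TorusPt g K) : (Cl g K)ˣ :=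
  Units.map (algebraMap K (Cl g K) : K →* Cl g K) t.2 *
    (List.ofFn fun i => torusFactor g K i (t.1 i)).prod

/-- The character lattice of the maximal torus: `(m; n)` is `(a; z) ↦ z^n ∏ a_i^{m_i}`. In the
coordinates where the roots are `±ε_i`, `±ε_i ± ε_j` and the minuscule weight is
`(1/2, …, 1/2; 1/2)`, it is `(m_1 - n/2, …, m_g - n/2; n/2)`. -/
abbrev X (g : ℕ) : Type := (Fin g → ℤ) × ℤ

/-- Evaluation of a character at a point of the torus. -/
def charEval {g : ℕ} {K : Type*} [Field K] (χ : X g) (t : TorusPt g K) : Kˣ :=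
  (∏ i, t.1 i ^ χ.1 i) * t.2 ^ χ.2

/-- The multiplier (spinor norm) `ν(a; z) = z² ∏ a_i`. -/
def nu (g : ℕ) : X g := (fun _ => 1, 2)

/-- The minuscule weight, `(a; z) ↦ z ∏ a_i`. -/
def minuscule (g : ℕ) : X g := (fun _ => 1, 1)

/-- The fundamental weights: `ε_1 + ⋯ + ε_i` for `i < g`, and the minuscule weight for `i = g`. -/
def fundWeight (g : ℕ) (i : Fin g) : X g :=
  if (i : ℕ) + 1 = g then minuscule g else (fun j => if j ≤ i then 1 else 0, 0)

/-- The action of the element `w_B` of `W' = {±1}^g` on characters: it replaces `ε_i` by `-ε_i`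
for `i ∈ B` and fixes `ν`. -/
def signAct {g : ℕ} (B : Finset (Fin g)) (χ : X g) : X g :=
  (fun i => if i ∈ B then χ.2 - χ.1 i else χ.1 i, χ.2)

/-- The weights `ε_i`, `-ε_i`, `0` of the basis vectors `e_i`, `e'_i`, `e_0` under conjugation by
the torus. -/
def wt {g : ℕ} : Idx g → X g
  | Sum.inl (Sum.inl i) => (Pi.single i 1, 0)
  | Sum.inl (Sum.inr i) => (-Pi.single i 1, 0)
  | Sum.inr _ => 0

/-- The roots `±ε_i ± ε_j` (`i ≠ j`) and `±ε_i` of `GSpin_{2g+1}`. -/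
def roots (g : ℕ) : Set (X g) :=
  {α | ∃ j k : Idx g, j ≠ k ∧ wt j + wt k = α ∧ α ≠ 0}

/-- The pairing `⟨χ, α^∨⟩ = 2 (χ, α) / (α, α)` of a character with the coroot of a root `α`. -/
def pair {g : ℕ} (χ α : X g) : ℚ :=
  2 * (∑ i, ((χ.1 i : ℚ) - (χ.2 : ℚ) / 2) * (α.1 i : ℚ)) / ∑ i, (α.1 i : ℚ) ^ 2

/-- The points `1 + s b_j b_k` (`s ∈ K`) of the root subgroup `U_α`, `α = wt j + wt k`. -/
def IsRootElt {g : ℕ} {K : Type*} [Field K] (α : X g) (u : (Cl g K)ˣ) : Prop :=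
  ∃ (j k : Idx g) (s : K), j ≠ k ∧ wt j + wt k = α ∧
    (u : Cl g K) = 1 + s • (bvec g K j * bvec g K k)

/-! ### The subgroup `H⁰` -/

/-- `Φ` is the root system of a connected reductive subgroup of `GSpin_{2g+1}` which contains the
maximal torus, is normalized by `W'` and has semisimple rank `g`: it is a closed symmetric set of
roots, stable under `W'`, of rank `g`. -/
structure IsSubsystem {g : ℕ} (Φ : Set (X g)) : Prop where
  subset : Φ ⊆ roots g
  neg_mem : ∀ α ∈ Φ, -α ∈ Φ
  add_mem : ∀ α ∈ Φ, ∀ β ∈ Φ, α + β ∈ roots g → α + β ∈ Φ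
  signAct_mem : ∀ (B : Finset (Fin g)), ∀ α ∈ Φ, signAct B α ∈ Φ
  rank : Module.finrank ℤ (Submodule.span ℤ Φ) = g

/-- `Δ` is a basis of the root system `Φ`. -/
structure IsBase {g : ℕ} (Φ Δ : Set (X g)) : Prop where
  subset : Δ ⊆ Φ
  indep : LinearIndepOn ℤ id Δ
  pos_or_neg : ∀ α ∈ Φ, α ∈ AddSubmonoid.closure Δ ∨ -α ∈ AddSubmonoid.closure Δ

/-- The `K`-points of the reductive subgroup `H⁰` with root system `Φ`: the subgroup generated by
the maximal torus and the root subgroups `U_α`, `α ∈ Φ`. -/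
def H0 (g : ℕ) (K : Type*) [Field K] (Φ : Set (X g)) : Subgroup (Cl g K)ˣ :=
  Subgroup.closure ({u | ∃ t : TorusPt g K, u = torusElt t} ∪ {u | ∃ α ∈ Φ, IsRootElt α u})

theorem torusElt_mem {g : ℕ} {K : Type*} [Field K] (Φ : Set (X g)) (t : TorusPt g K) :
    torusElt t ∈ H0 g K Φ :=
  Subgroup.subset_closure (Or.inl ⟨t, rfl⟩)

theorem wt_orth {g : ℕ} {K : Type*} [Field K] {j k : Idx g} (hjk : j ≠ k)
    (h : wt j + wt k ≠ 0) :
    bvec g K k * bvec g K j = -(bvec g K j * bvec g K k) ∧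
      quadForm g K (Pi.single j 1) * quadForm g K (Pi.single k 1) = 0 := by
  have hp : QuadraticMap.polar (quadForm g K) (Pi.single k 1) (Pi.single j 1) = 0 ∧
      quadForm g K (Pi.single j 1) * quadForm g K (Pi.single k 1) = 0 := by
    rcases j with (j | j) | j <;> rcases k with (k | k) | k <;>
      simp [QuadraticMap.polar, quadForm_apply, Pi.single_apply, wt] at hjk h ⊢
    · rintro rfl; simp at h
    · rintro rfl; simp at h
  refine ⟨?_, hp.2⟩
  have := CliffordAlgebra.ι_mul_ι_add_swap (Q := quadForm g K) (Pi.single k 1) (Pi.single j 1)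
  rw [hp.1, map_zero] at this
  exact eq_neg_of_add_eq_zero_left this

theorem conj_two {g : ℕ} {K : Type*} [Field K] (u : (Cl g K)ˣ) (a b : Idx g → K) (s s' : K)
    (hu : (u : Cl g K) = 1 + s • (CliffordAlgebra.ι (quadForm g K) a *
      CliffordAlgebra.ι (quadForm g K) b))
    (hu' : ((u⁻¹ : (Cl g K)ˣ) : Cl g K) = 1 + s' • (CliffordAlgebra.ι (quadForm g K) a *
      CliffordAlgebra.ι (quadForm g K) b)) : IsEvenClifford u := by
  refine ⟨?_, fun x => ?_⟩
  · rw [hu]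
    refine Submodule.add_mem _ ?_ (Submodule.smul_mem _ _ ?_)
    · exact SetLike.GradedOne.one_mem (A := CliffordAlgebra.evenOdd (quadForm g K))
    · exact CliffordAlgebra.ι_mul_ι_mem_evenOdd_zero _ _ _
  · set A := CliffordAlgebra.ι (quadForm g K) a
    set B := CliffordAlgebra.ι (quadForm g K) b
    set Y := CliffordAlgebra.ι (quadForm g K) x with hY
    have hbx : B * Y = algebraMap K _ (QuadraticMap.polar (quadForm g K) b x) - Y * B := by
      rw [← CliffordAlgebra.ι_mul_ι_add_swap]; abel
    have hax : A * Y = algebraMap K _ (QuadraticMap.polar (quadForm g K) a x) - Y * A := by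
      rw [← CliffordAlgebra.ι_mul_ι_add_swap]; abel
    have hba : B * A = algebraMap K _ (QuadraticMap.polar (quadForm g K) b a) - A * B := by
      rw [← CliffordAlgebra.ι_mul_ι_add_swap]; abel
    have hAA : A * A = algebraMap K _ (quadForm g K a) := CliffordAlgebra.ι_sq_scalar _ _
    have hBB : B * B = algebraMap K _ (quadForm g K b) := CliffordAlgebra.ι_sq_scalar _ _
    generalize QuadraticMap.polar (quadForm g K) b x = p at *
    generalize QuadraticMap.polar (quadForm g K) a x = r at *
    generalize QuadraticMap.polar (quadForm g K) b a = m at *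
    generalize quadForm g K a = qa at *
    generalize quadForm g K b = qb at *
    have key : A * B * Y = Y * (A * B) + p • A - r • B := by
      rw [mul_assoc, hbx, mul_sub, ← mul_assoc A Y B, hax, sub_mul, ← Algebra.commutes,
        ← Algebra.smul_def, ← Algebra.smul_def, mul_assoc]
      abel
    have hAAB : A * (A * B) = qa • B := by rw [← mul_assoc, hAA, Algebra.smul_def]
    have hBAB : B * (A * B) = m • B - qb • A := by
      rw [← mul_assoc, hba, sub_mul, mul_assoc A B B, hBB, ← Algebra.commutes, ← Algebra.smul_def,
        ← Algebra.smul_def]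
    have hinv : (1 + s • (A * B)) * (1 + s' • (A * B)) = 1 := by
      rw [← hu, ← hu']; simp
    refine ⟨x + s • (p • a - r • b) + (s * s') • (p • qa • b - r • (m • b - qb • a)), ?_⟩
    rw [hu, hu']
    have e1 : (1 + s • (A * B)) * Y = Y * (1 + s • (A * B)) + s • (p • A - r • B) := by
      rw [add_mul, smul_mul_assoc, key, mul_add, mul_smul_comm, one_mul, mul_one]
      module
    rw [e1, add_mul, mul_assoc, hinv, mul_one, mul_add, mul_one, mul_smul_comm, smul_mul_assoc,
      sub_mul, smul_mul_assoc, smul_mul_assoc, hAAB, hBAB]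
    simp only [map_add, map_sub, map_smul]
    change _ = Y + s • (p • A - r • B) + (s * s') • (p • qa • B - r • (m • B - qb • A))
    module

/-- `H⁰` is a subgroup of `GSpin_{2g+1}`. -/
theorem H0_le_GSpin {g : ℕ} {K : Type*} [Field K] {Φ : Set (X g)} (hΦ : Φ ⊆ roots g) :
    H0 g K Φ ≤ GSpin g K := by
  refine (Subgroup.closure_le _).2 ?_
  rintro u (⟨t, rfl⟩ | ⟨α, hα, j, k, s, hjk, hα', hu⟩)
  · refine mul_mem ?_ (Subgroup.list_prod_mem _ ?_)
    · have h : ∀ c : Kˣ, IsEvenClifford (Units.map (algebraMap K (Cl g K) : K →* Cl g K) c) := by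
        refine fun c => ⟨?_, fun x => ⟨x, ?_⟩⟩
        · exact SetLike.algebraMap_mem_graded (CliffordAlgebra.evenOdd (quadForm g K)) _
        · rw [← map_inv]
          simp only [Units.coe_map, MonoidHom.coe_coe]
          rw [Algebra.commutes, mul_assoc, ← map_mul]
          simp
      exact ⟨h _, by rw [← map_inv]; exact h _⟩
    · intro v hv
      obtain ⟨i, rfl⟩ := List.mem_ofFn.1 hv
      exact ⟨conj_two _ _ _ _ _ rfl rfl, conj_two _ _ _ _ _ rfl rfl⟩
  · obtain ⟨_, _, _, _, h0⟩ := hΦ hα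
    obtain ⟨hanti, hq⟩ := wt_orth (K := K) hjk (hα' ▸ h0)
    have hinv : ((u⁻¹ : (Cl g K)ˣ) : Cl g K) = 1 + (-s) • (bvec g K j * bvec g K k) := by
      refine Units.inv_eq_of_mul_eq_one_right ?_
      have hsq : (bvec g K j * bvec g K k) * (bvec g K j * bvec g K k) = 0 := by
        calc _ = bvec g K j * (bvec g K k * bvec g K j) * bvec g K k := by simp only [mul_assoc]
          _ = -((bvec g K j * bvec g K j) * (bvec g K k * bvec g K k)) := by
            rw [hanti]; simp only [mul_neg, neg_mul, mul_assoc]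
          _ = 0 := by
            simp only [bvec, CliffordAlgebra.ι_sq_scalar, ← map_mul, hq, map_zero, neg_zero]
      rw [hu]
      simp only [mul_add, add_mul, mul_one, one_mul, smul_mul_smul_comm, hsq, smul_zero]
      module
    exact ⟨conj_two _ _ _ _ _ hu hinv, conj_two _ _ _ _ _ hinv (by rw [inv_inv]; exact hu)⟩

/-! ### Rational representations of `H⁰` over a subfield -/

/-- The `k`-algebra of regular functions, defined over `k`, on the units of the Clifford algebra
over an extension `K` of `k`: it is generated by the coordinates of `u` and of `u⁻¹` with respect
to the `k`-structure spanned by the products of basis vectors. -/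
def regularFunctions (g : ℕ) (k K : Type*) [Field k] [Field K] [Algebra k K] :
    Subalgebra k ((Cl g K)ˣ → K) :=
  Algebra.adjoin k {f | ∃ φ : Cl g K →ₗ[K] K,
    (∀ l : List (Idx g), φ ((l.map (bvec g K)).prod) ∈ Set.range (algebraMap k K)) ∧
    ((f = fun u : (Cl g K)ˣ => φ (u : Cl g K)) ∨
      (f = fun u : (Cl g K)ˣ => φ ((u⁻¹ : (Cl g K)ˣ) : Cl g K)))}

/-- A rational representation of the `k`-group `H⁰` on `k^n`, given on points over the algebraic
closure. -/
structure RatRep (g : ℕ) (k : Type*) [Field k] (Φ : Set (X g)) (n : ℕ) where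
  toHom : H0 g (AlgebraicClosure k) Φ →* Matrix (Fin n) (Fin n) (AlgebraicClosure k)
  regular : ∀ i j, ∃ f ∈ regularFunctions g k (AlgebraicClosure k),
    ∀ h : H0 g (AlgebraicClosure k) Φ, toHom h i j = f h

/-- Simplicity as an `H⁰_k`-module: `k^n` is nonzero and its only `k`-subspaces `U` such that
`U ⊗ k̄` is stable under `H⁰(k̄)` are `0` and `k^n`. -/
def RatRep.IsSimple {g : ℕ} {k : Type*} [Field k] {Φ : Set (X g)} {n : ℕ}
    (ρ : RatRep g k Φ n) : Prop :=
  0 < n ∧ ∀ U : Submodule k (Fin n → k),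
    (∀ h, ∀ x ∈ U, (ρ.toHom h).mulVec (fun i => algebraMap k (AlgebraicClosure k) (x i)) ∈
      Submodule.span (AlgebraicClosure k)
        ((fun (y : Fin n → k) (i : Fin n) => algebraMap k (AlgebraicClosure k) (y i)) ''
          (U : Set (Fin n → k)))) →
    U = ⊥ ∨ U = ⊤

/-- `x` lies in the weight space of weight `χ`. -/
def RatRep.IsWeightVec {g : ℕ} {k : Type*} [Field k] {Φ : Set (X g)} {n : ℕ}
    (ρ : RatRep g k Φ n) (χ : X g) (x : Fin n → AlgebraicClosure k) : Prop :=
  ∀ t : TorusPt g (AlgebraicClosure k),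
    (ρ.toHom ⟨torusElt t, torusElt_mem Φ t⟩).mulVec x =
      ((charEval χ t : (AlgebraicClosure k)ˣ) : AlgebraicClosure k) • x

/-- The set of weights of a representation. -/
def RatRep.weights {g : ℕ} {k : Type*} [Field k] {Φ : Set (X g)} {n : ℕ}
    (ρ : RatRep g k Φ n) : Set (X g) :=
  {χ | ∃ x, x ≠ 0 ∧ ρ.IsWeightVec χ x}

/-- `μ` is a highest weight of `ρ` for the Borel subgroup of `H⁰` given by the basis `Δ`: there is
a nonzero vector of weight `μ` which is fixed by `U_α` for all positive `α ∈ Φ`. -/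
def RatRep.HasHighestWeight {g : ℕ} {k : Type*} [Field k] {Φ : Set (X g)} {n : ℕ}
    (ρ : RatRep g k Φ n) (Δ : Set (X g)) (μ : X g) : Prop :=
  ∃ x, x ≠ 0 ∧ ρ.IsWeightVec μ x ∧
    ∀ α ∈ Φ, α ∈ AddSubmonoid.closure Δ →
      ∀ h : H0 g (AlgebraicClosure k) Φ, IsRootElt α (h : (Cl g (AlgebraicClosure k))ˣ) →
        (ρ.toHom h).mulVec x = x

/-! ### The spin representation -/

/-- The action of a vector `∑ x_i e_i + ∑ x'_i e'_i + x_0 e_0` on the exterior algebra of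
`⟨e_1, …, e_g⟩`: exterior multiplication by `∑ x_i e_i`, plus twice the contraction with
`∑ x'_i e_i^*`, plus `x_0` times the grading involution. -/
def spinVec (g : ℕ) (K : Type*) [Field K] :
    (Idx g → K) →ₗ[K] Module.End K (ExteriorAlgebra K (Fin g → K)) :=
  ((LinearMap.mul K (ExteriorAlgebra K (Fin g → K))).comp (ExteriorAlgebra.ι K)).comp
      (LinearMap.funLeft K K fun i : Fin g => (Sum.inl (Sum.inl i) : Idx g)) +
    (2 : K) • CliffordAlgebra.contractLeft.comp
      (∑ i : Fin g, LinearMap.smulRight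
        (LinearMap.proj (Sum.inl (Sum.inr i)) : (Idx g → K) →ₗ[K] K)
        (LinearMap.proj i : (Fin g → K) →ₗ[K] K)) +
    LinearMap.smulRight (LinearMap.proj (Sum.inr ()) : (Idx g → K) →ₗ[K] K)
      (CliffordAlgebra.involute : ExteriorAlgebra K (Fin g → K) →ₐ[K] _).toLinearMap

theorem spinVec_apply (g : ℕ) (K : Type*) [Field K] (x : Idx g → K)
    (y : ExteriorAlgebra K (Fin g → K)) :
    spinVec g K x y =
      ExteriorAlgebra.ι K (fun i => x (Sum.inl (Sum.inl i))) * y +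
      (2 : K) • CliffordAlgebra.contractLeft
        (∑ i : Fin g, x (Sum.inl (Sum.inr i)) • (LinearMap.proj i : (Fin g → K) →ₗ[K] K)) y +
      x (Sum.inr ()) • CliffordAlgebra.involute y := by
  simp [spinVec, LinearMap.sum_apply]
  rfl

theorem involute_contractLeft {K M : Type*} [Field K] [AddCommGroup M] [Module K M]
    (d : Module.Dual K M) (y : ExteriorAlgebra K M) :
    CliffordAlgebra.involute (CliffordAlgebra.contractLeft d y) =
      -CliffordAlgebra.contractLeft d (CliffordAlgebra.involute y) := by
  induction y using CliffordAlgebra.left_induction with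
  | algebraMap r => simp
  | add x y hx hy => simp only [map_add, hx, hy, neg_add]
  | ι_mul m y h =>
    simp only [map_mul, CliffordAlgebra.contractLeft_ι_mul, map_sub, map_smul,
      CliffordAlgebra.involute_ι, h, neg_mul, map_neg]
    simp

theorem spinVec_sq (g : ℕ) (K : Type*) [Field K] (x : Idx g → K) :
    spinVec g K x * spinVec g K x = algebraMap K _ (quadForm g K x) := by
  refine LinearMap.ext fun y => ?_
  have hR : ∀ c : K, algebraMap K (Module.End K (ExteriorAlgebra K (Fin g → K))) c y = c • y :=
    fun _ => rfl
  rw [Module.End.mul_apply, spinVec_apply, spinVec_apply, quadForm_apply, hR]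
  set d : Module.Dual K (Fin g → K) :=
    ∑ i : Fin g, x (Sum.inl (Sum.inr i)) • (LinearMap.proj i : (Fin g → K) →ₗ[K] K) with hd
  set v : Fin g → K := fun i => x (Sum.inl (Sum.inl i)) with hv
  have hdv : d v = ∑ i : Fin g, x (Sum.inl (Sum.inr i)) * x (Sum.inl (Sum.inl i)) := by
    simp [hd, hv, LinearMap.sum_apply]
  have h1 : ExteriorAlgebra.ι K v * (ExteriorAlgebra.ι K v * y) = 0 := by
    rw [← mul_assoc, ExteriorAlgebra.ι_sq_zero, zero_mul]
  simp only [mul_add, map_add, map_smul, map_mul, mul_smul_comm, h1,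
    CliffordAlgebra.contractLeft_ι_mul, CliffordAlgebra.contractLeft_contractLeft,
    CliffordAlgebra.involute_ι, CliffordAlgebra.involute_involute, involute_contractLeft,
    ← Finset.mul_sum]
  have h2 : ∑ i : Fin g, x (Sum.inl (Sum.inl i)) * x (Sum.inl (Sum.inr i)) = d v := by
    rw [hdv]; exact Finset.sum_congr rfl fun i _ => mul_comm _ _
  rw [h2]
  simp only [smul_add, smul_sub, smul_smul, add_smul, neg_mul, smul_neg, smul_zero]
  module

/-- The spin representation of the Clifford algebra (hence of `GSpin_{2g+1}`) on the exterior
algebra of `⟨e_1, …, e_g⟩`. -/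
def spinRep (g : ℕ) (K : Type*) [Field K] :
    Cl g K →ₐ[K] Module.End K (ExteriorAlgebra K (Fin g → K)) :=
  CliffordAlgebra.lift (quadForm g K) ⟨spinVec g K, spinVec_sq g K⟩

/-- The set of weights of the spin representation over the algebraic closure of `k`. -/
def spinWeights (g : ℕ) (k : Type*) [Field k] : Set (X g) :=
  {χ | ∃ y : ExteriorAlgebra (AlgebraicClosure k) (Fin g → AlgebraicClosure k), y ≠ 0 ∧
    ∀ t : TorusPt g (AlgebraicClosure k),
      spinRep g (AlgebraicClosure k) ((torusElt t : (Cl g (AlgebraicClosure k))ˣ) : Cl g _) y =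
        ((charEval χ t : (AlgebraicClosure k)ˣ) : AlgebraicClosure k) • y}

/-! ### Restriction to torus points, and reduced weights -/

/-- The characters `χ` and `η` have the same restriction to the group of `k`-points of the torus
whose multiplier is a `w`-th power in `k^×`. -/
def SameRestriction {g : ℕ} (k : Type*) [Field k] (w : ℕ) (χ η : X g) : Prop :=
  ∀ t : TorusPt g k, (∃ y : kˣ, charEval (nu g) t = y ^ w) → charEval χ t = charEval η t

/-- `μ` is `q`-reduced: `μ = v + a ν` with `v` in the span of the fundamental weights,
`0 ≤ a ≤ e - 1` where `e = (q - 1) / gcd(w, q - 1)`, and `0 ≤ ⟨v, β^∨⟩ ≤ q - 1` for the simple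
roots `β ∈ Δ`. -/
def IsReduced {g : ℕ} (q w : ℕ) (Δ : Set (X g)) (μ : X g) : Prop :=
  ∃ (v : X g) (a : ℕ), v ∈ AddSubgroup.closure (Set.range (fundWeight g)) ∧
    a < (q - 1) / Nat.gcd w (q - 1) ∧ μ = v + a • nu g ∧
    ∀ β ∈ Δ, 0 ≤ pair v β ∧ pair v β ≤ (q : ℚ) - 1

/-- Every weight of `ρ` has the same restriction as some weight of the spin representation. -/
def WeightsInSpin {g : ℕ} {k : Type*} [Field k] {Φ : Set (X g)} {n : ℕ} (w : ℕ)
    (ρ : RatRep g k Φ n) : Prop :=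
  ∀ χ ∈ ρ.weights, ∃ η ∈ spinWeights g k, SameRestriction k w χ η

/-- For `g = 2`: the long roots `±ε_1 ± ε_2`, the root system of the subgroup
`(GL_2 × GL_2)⁰` of `GSpin_5` (whose intersection with `Spin_5 ≅ Sp_4` is `SL_2 × SL_2`). -/
def longRoots : Set (X 2) :=
  {(![1, 1], 0), (![1, -1], 0), (![-1, 1], 0), (![-1, -1], 0)}

end

end SpinLemma

/-! Part 1 is an `SL₂` argument at one simple root at a time. Write `μ = v + aν`, fix `β ∈ Δ`, and
put `m = ⟨v, β^∨⟩ ∈ [0, q-1]` and `m₀ = ⟨ϖ̂, β^∨⟩ ∈ {-1, 0, 1}`. The multiplier is trivial on the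
image of `β^∨`, so the equality of restrictions forces `m ≡ m₀` modulo `q-1`
(`SameRestriction.dvd_of_pair`). If `m ≠ m₀`, then `m = q-1+m₀` with `m₀ ∈ {-1, 0}`. Hence `m`
equals `-1` or `-2` in `k`, the lowering operator for `β` does not kill the highest weight vector,
and `μ - β` is a weight of `W` (`RatRep.sub_mem_weights`). Its pairing `m - 2` must be congruent to
the pairing `m' ∈ {-1, 0, 1}` of a spin weight, so `q-1` divides `m' + 2 - m₀ ∈ [1, 4]`, which is
impossible for `q ≥ 7`.

Thus `v - ϖ̂` is orthogonal to `Φ`. As `Φ` has rank `g`, it is a rational multiple of `ν`, and it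
vanishes because `X'` meets that line only in `0`. Finally `ν` has order `e` on the restricted
torus, so `a < e` gives `a = 0`.

For `q = 5` the extreme case `m₀ = -1`, `m' = 1` survives, and it is realized. For the long roots of
`g = 2`, the even half of the spin representation has weights `ϖ̂` and `η = ν - ϖ̂`, and one `SL₂`
factor acts on it in the standard way, the other trivially. Its symmetric cube is simple when `2`
and `3` are invertible, with weights `3ϖ̂, ϖ̂ + ν, η + ν, 3η`; the cube of the dual has the opposite
weights. Fourth powers are trivial in `F_5^×`, so these are spin weights up to multiples of `ν`,
which the condition on `w` kills.

Representations are given on points only. The lowering operator is therefore the linear coefficient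
of the polynomial orbit map of a root subgroup. -/

namespace SpinLemma
open CliffordAlgebra

/-! ### Clifford relations and conjugation by the torus -/

section Clifford

variable {g : ℕ} {K : Type*} [Field K]

/-- The index of the basis vector dual to `b_j`. -/
def dualIdx : Idx g → Idx g
  | Sum.inl (Sum.inl i) => Sum.inl (Sum.inr i)
  | Sum.inl (Sum.inr i) => Sum.inl (Sum.inl i)
  | Sum.inr u => Sum.inr u

theorem wt_dualIdx (j : Idx g) : wt (dualIdx j) = -wt j := by
  rcases j with (j | j) | j <;> simp [wt, dualIdx]

theorem bvec_mul_bvec_swap (j k : Idx g) (h : k ≠ dualIdx j) :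
    bvec g K k * bvec g K j = -(bvec g K j * bvec g K k) := by
  have hp : QuadraticMap.polar (quadForm g K) (Pi.single k 1) (Pi.single j 1) = 0 := by
    rcases j with (j | j) | j <;> rcases k with (k | k) | k <;>
      simp_all [QuadraticMap.polar, quadForm_apply, Pi.single_apply, dualIdx]
    exact fun h' => absurd h'.symm h
  have := ι_mul_ι_add_swap (Q := quadForm g K) (Pi.single k 1) (Pi.single j 1)
  rw [hp, map_zero] at this
  exact eq_neg_of_add_eq_zero_left this

theorem bvec_mul_dual_add (j : Idx g) :
    bvec g K j * bvec g K (dualIdx j) + bvec g K (dualIdx j) * bvec g K j = 2 := by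
  have hp : QuadraticMap.polar (quadForm g K) (Pi.single j 1) (Pi.single (dualIdx j) 1) = 2 := by
    rcases j with (j | j) | j
    · exact polar_single g K j
    · rw [QuadraticMap.polar_comm]; exact polar_single g K j
    · simp [QuadraticMap.polar, quadForm_apply, dualIdx]
      norm_num
  have := ι_mul_ι_add_swap (Q := quadForm g K) (Pi.single j 1) (Pi.single (dualIdx j) 1)
  rw [hp, map_ofNat] at this
  exact this

theorem bvec_sq_inl (j : Fin g ⊕ Fin g) :
    bvec g K (Sum.inl j) * bvec g K (Sum.inl j) = 0 := by
  rcases j with j | j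
  · exact bvec_sq_left g K j
  · exact bvec_sq_right g K j

theorem bvec_sq_inr : bvec g K (Sum.inr ()) * bvec g K (Sum.inr ()) = 1 := by
  rw [bvec, ι_sq_scalar, quadForm_apply]
  simp

theorem torusFactor_mul_bvec (h2 : (2 : K) ≠ 0) (i : Fin g) (a : Kˣ) (j : Idx g) :
    (torusFactor g K i a : Cl g K) * bvec g K j =
      ((a ^ (wt j).1 i : Kˣ) : K) • (bvec g K j * (torusFactor g K i a : Cl g K)) := by
  have hee := bvec_sq_left g K i
  have hff := bvec_sq_right g K i
  have hef := bvec_mul_dual_add (K := K) (Sum.inl (Sum.inl i) : Idx g)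
  simp only [torusFactor, dualIdx] at *
  by_cases hj : j = Sum.inl (Sum.inl i)
  · subst hj
    generalize bvec g K (Sum.inl (Sum.inl i)) = e at *
    generalize bvec g K (Sum.inl (Sum.inr i)) = f at *
    have hfe : f * e = 2 - e * f := by rw [← hef]; abel
    have h2' : e * 2 = (2 : K) • e := by rw [two_smul, mul_two]
    have h3 : e * f * e = (2 : K) • e := by
      rw [mul_assoc, hfe, mul_sub, ← mul_assoc, hee, zero_mul, sub_zero, h2']
    simp only [wt, Pi.single_eq_same, zpow_one, add_mul, mul_add, one_mul, mul_one,
      smul_mul_assoc, mul_smul_comm, h3, ← mul_assoc, hee, zero_mul, smul_zero, add_zero, smul_smul]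
    rw [← one_smul K e, smul_smul, smul_smul, ← add_smul]
    congr 1; field_simp; ring
  by_cases hj' : j = Sum.inl (Sum.inr i)
  · subst hj'
    generalize bvec g K (Sum.inl (Sum.inl i)) = e at *
    generalize bvec g K (Sum.inl (Sum.inr i)) = f at *
    have hfe : f * e = 2 - e * f := by rw [← hef]; abel
    have h2' : 2 * f = (2 : K) • f := by rw [two_smul, two_mul]
    have h3 : f * (e * f) = (2 : K) • f := by
      rw [← mul_assoc, hfe, sub_mul, mul_assoc, hff, mul_zero, sub_zero, h2']
    simp only [wt, Pi.single_eq_same, Pi.neg_apply, zpow_neg, zpow_one, add_mul, mul_add, one_mul,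
      mul_one, smul_mul_assoc, mul_smul_comm, h3, mul_assoc, hff, mul_zero, smul_zero, add_zero,
      smul_smul]
    nth_rw 1 2 [← one_smul K f]
    rw [← add_smul, smul_smul, Units.val_inv_eq_inv_val]
    congr 1; field_simp [a.ne_zero]; ring
  · have h1 := bvec_mul_bvec_swap (K := K) j (Sum.inl (Sum.inl i)) (by
      rcases j with (j | j) | j <;> simp_all [dualIdx] <;> tauto)
    have h2 := bvec_mul_bvec_swap (K := K) j (Sum.inl (Sum.inr i)) (by
      rcases j with (j | j) | j <;> simp_all [dualIdx] <;> tauto)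
    have h0 : (wt j).1 i = 0 := by
      rcases j with (j | j) | j <;> simp_all [wt]
    rw [h0, zpow_zero, Units.val_one, one_smul, add_mul, mul_add, smul_mul_assoc, mul_smul_comm,
      mul_assoc, h2, mul_neg, ← mul_assoc, h1, neg_mul, neg_neg, mul_assoc, one_mul, mul_one]

theorem list_prod_torusFactor_mul_bvec (h2 : (2 : K) ≠ 0) (a : Fin g → Kˣ) (j : Idx g)
    (L : List (Fin g)) :
    (((L.map fun i => torusFactor g K i (a i)).prod : (Cl g K)ˣ) : Cl g K) * bvec g K j =
      (((L.map fun i => a i ^ (wt j).1 i).prod : Kˣ) : K) •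
        (bvec g K j * (((L.map fun i => torusFactor g K i (a i)).prod : (Cl g K)ˣ) : Cl g K)) := by
  induction L with
  | nil => simp
  | cons i L ih =>
    simp only [List.map_cons, List.prod_cons, Units.val_mul]
    rw [mul_assoc, ih, mul_smul_comm, ← mul_assoc, torusFactor_mul_bvec h2, smul_mul_assoc,
      smul_smul, mul_assoc, mul_comm]

/-- The torus acts on `b_j` by conjugation through the character `wt j`. -/
theorem torusElt_mul_bvec (h2 : (2 : K) ≠ 0) (t : TorusPt g K) (j : Idx g) :
    (torusElt t : Cl g K) * bvec g K j =
      (charEval (wt j) t : K) • (bvec g K j * (torusElt t : Cl g K)) := by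
  have h := list_prod_torusFactor_mul_bvec h2 t.1 j (List.finRange g)
  have hz : (wt j).2 = 0 := by rcases j with (j | j) | j <;> rfl
  rw [torusElt, List.ofFn_eq_map, charEval, hz, zpow_zero, mul_one, ← List.prod_ofFn,
    List.ofFn_eq_map, Units.val_mul, mul_assoc, h]
  simp only [Units.coe_map, MonoidHom.coe_coe]
  rw [mul_smul_comm, ← mul_assoc, Algebra.commutes, mul_assoc]

theorem charEval_add (χ η : X g) (t : TorusPt g K) :
    charEval (χ + η) t = charEval χ t * charEval η t := by
  simp only [charEval, Prod.fst_add, Prod.snd_add, Pi.add_apply, zpow_add, Finset.prod_mul_distrib]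
  exact mul_mul_mul_comm _ _ _ _

theorem charEval_zero (t : TorusPt g K) : charEval 0 t = 1 := by
  simp [charEval]

theorem charEval_neg (χ : X g) (t : TorusPt g K) : charEval (-χ) t = (charEval χ t)⁻¹ := by
  rw [eq_inv_iff_mul_eq_one, ← charEval_add, neg_add_cancel, charEval_zero]

theorem charEval_sub (χ η : X g) (t : TorusPt g K) :
    charEval (χ - η) t = charEval χ t / charEval η t := by
  rw [sub_eq_add_neg, charEval_add, charEval_neg, div_eq_mul_inv]

theorem charEval_zsmul (n : ℤ) (χ : X g) (t : TorusPt g K) :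
    charEval (n • χ) t = charEval χ t ^ n := by
  simp only [charEval, Prod.smul_fst, Prod.smul_snd, Pi.smul_apply, smul_eq_mul, mul_zpow,
    Finset.prod_zpow, mul_comm n, zpow_mul]

theorem charEval_nsmul (n : ℕ) (χ : X g) (t : TorusPt g K) :
    charEval (n • χ) t = charEval χ t ^ n := by
  rw [← natCast_zsmul, charEval_zsmul, zpow_natCast]

theorem torusElt_mul_bvec_mul_bvec (h2 : (2 : K) ≠ 0) (t : TorusPt g K) (j k : Idx g) :
    (torusElt t : Cl g K) * (bvec g K j * bvec g K k) =
      (charEval (wt j + wt k) t : K) • (bvec g K j * bvec g K k * (torusElt t : Cl g K)) := by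
  rw [← mul_assoc, torusElt_mul_bvec h2, smul_mul_assoc, mul_assoc, torusElt_mul_bvec h2,
    mul_smul_comm, smul_smul, charEval_add, Units.val_mul, mul_assoc]

/-- The torus point whose coordinates are `1`, except for `a_i = a` and `z`. -/
def torusPtSingle (i : Fin g) (a z : Kˣ) : TorusPt g K := (Pi.mulSingle i a, z)

theorem charEval_torusPtSingle (χ : X g) (i : Fin g) (a z : Kˣ) :
    charEval χ (torusPtSingle i a z) = a ^ χ.1 i * z ^ χ.2 := by
  rw [charEval, torusPtSingle]
  congr 1
  rw [Finset.prod_eq_single i]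
  · simp
  · intro b _ hb; simp [Pi.mulSingle_eq_of_ne hb]
  · simp

theorem torusElt_torusPtSingle (i : Fin g) (a z : Kˣ) :
    (torusElt (torusPtSingle i a z) : Cl g K) = (z : K) • (torusFactor g K i a : Cl g K) := by
  have h1 : ∀ i, torusFactor g K i 1 = 1 := fun i => by ext; simp [torusFactor]
  rw [torusElt, torusPtSingle, List.ofFn_eq_map, Units.val_mul,
    List.prod_map_eq_pow_single i _ (fun b hb _ => by
      simp only [Pi.mulSingle_eq_of_ne hb, h1]),
    List.count_eq_one_of_mem (List.nodup_finRange g) (List.mem_finRange i), pow_one,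
    Algebra.smul_def]
  simp only [Pi.mulSingle_eq_same]
  rfl

/-- The weights of `e_j` and `e'_j` cancel, so their product commutes with every torus factor. -/
theorem commute_torusFactor (h2 : (2 : K) ≠ 0) (i j : Fin g) (a b : Kˣ) :
    Commute (torusFactor g K i a) (torusFactor g K j b) := by
  have h : Commute (torusFactor g K i a : Cl g K)
      (bvec g K (Sum.inl (Sum.inl j)) * bvec g K (Sum.inl (Sum.inr j))) := by
    rw [Commute, SemiconjBy, ← mul_assoc, torusFactor_mul_bvec h2, smul_mul_assoc, mul_assoc,
      torusFactor_mul_bvec h2, mul_smul_comm, smul_smul, ← Units.val_mul, ← zpow_add]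
    simp [wt, mul_assoc]
  refine Units.ext ?_
  exact ((Commute.one_right _).add_right (h.smul_right _)).eq

theorem torusFactor_map_mul (h2 : (2 : K) ≠ 0) (i : Fin g) (a b : Kˣ) :
    torusFactor g K i (a * b) = torusFactor g K i a * torusFactor g K i b := by
  ext
  have h := bvec_idem g K i
  simp only [torusFactor, Units.val_mul]
  generalize bvec g K (Sum.inl (Sum.inl i)) * bvec g K (Sum.inl (Sum.inr i)) = E at *
  simp only [mul_add, add_mul, mul_one, one_mul, smul_mul_smul_comm, h, smul_smul]
  rw [add_assoc, ← add_smul, ← add_smul]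
  congr 2
  field_simp
  ring

theorem torusElt_mul (h2 : (2 : K) ≠ 0) (t t' : TorusPt g K) :
    torusElt (t * t') = torusElt t * torusElt t' := by
  have key : ∀ L : List (Fin g), (L.map fun i => torusFactor g K i ((t * t').1 i)).prod =
      (L.map fun i => torusFactor g K i (t.1 i)).prod *
        (L.map fun i => torusFactor g K i (t'.1 i)).prod := by
    intro L
    induction L with
    | nil => simp
    | cons i L ih =>
      have hc : Commute (torusFactor g K i (t'.1 i))
          (L.map fun i => torusFactor g K i (t.1 i)).prod :=
        Commute.list_prod_right _ _ fun x hx => by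
          obtain ⟨j, _, rfl⟩ := List.mem_map.1 hx
          exact commute_torusFactor h2 _ _ _ _
      simp only [List.map_cons, List.prod_cons]
      rw [ih, Prod.fst_mul, Pi.mul_apply, torusFactor_map_mul h2, mul_assoc, mul_assoc,
        ← mul_assoc _ _ (List.prod _), hc.eq, mul_assoc]
  simp only [torusElt, List.ofFn_eq_map, key, Prod.snd_mul, map_mul]
  have hc : Commute (Units.map (algebraMap K (Cl g K) : K →* Cl g K) t'.2)
      (((List.finRange g).map fun i => torusFactor g K i (t.1 i)).prod) :=
    Units.ext (Algebra.commutes _ _)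
  rw [mul_assoc, mul_assoc, ← mul_assoc _ _ (List.prod _), hc.eq, mul_assoc]

end Clifford
end SpinLemma

namespace SpinLemma
open CliffordAlgebra

/-! ### Coroots as one-parameter subgroups -/

section Coroot

variable {g : ℕ} {K : Type*} [Field K]

/-- The one-parameter subgroup `a ↦ (a^{c_1}, …, a^{c_g}; a^z)` of the torus. -/
def cocharEval (c : X g) (a : Kˣ) : TorusPt g K := (fun i => a ^ c.1 i, a ^ c.2)

/-- The coroot of a root of `GSpin_{2g+1}`. -/
def coroot (β : X g) : X g :=
  -- Both integer divisions are exact on roots: the square length is `1` or `2`, and the coordinate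
  -- sum has the same parity. The last coordinate is the one that makes `ν` trivial on the coroot.
  (fun i => 2 * β.1 i / ∑ i, β.1 i ^ 2, -(∑ i, β.1 i) / ∑ i, β.1 i ^ 2)

theorem charEval_cocharEval (χ c : X g) (a : Kˣ) :
    charEval χ (cocharEval c a) = a ^ (∑ i, χ.1 i * c.1 i + χ.2 * c.2) := by
  have h : ∀ (s : Finset (Fin g)) (f : Fin g → ℤ), ∏ i ∈ s, a ^ f i = a ^ ∑ i ∈ s, f i := by
    intro s f
    classical
    induction s using Finset.induction_on with
    | empty => simp
    | insert i s hi ih => rw [Finset.prod_insert hi, Finset.sum_insert hi, ih, zpow_add]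
  simp only [charEval, cocharEval, ← zpow_mul, h, zpow_add, mul_comm]

theorem cocharEval_add (c d : X g) (a : Kˣ) :
    cocharEval (c + d) a = cocharEval c a * cocharEval d a := by
  ext <;> simp [cocharEval, zpow_add]

/-- The cocharacter with `a ↦ 1 + (a - 1) b_j b_{j'} / 2`, for an isotropic basis vector `b_j`
with dual `b_{j'}`. -/
def idemCochar : Fin g ⊕ Fin g → X g
  | Sum.inl i => (Pi.single i 1, 0)
  | Sum.inr i => (-Pi.single i 1, 1)

theorem torusElt_idemCochar (h2 : (2 : K) ≠ 0) (j : Fin g ⊕ Fin g) (a : Kˣ) :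
    (torusElt (cocharEval (idemCochar j) a) : Cl g K) =
      1 + (((a : K) - 1) / 2) • (bvec g K (Sum.inl j) * bvec g K (dualIdx (Sum.inl j))) := by
  rcases j with i | i
  · have : cocharEval (idemCochar (Sum.inl i)) a = torusPtSingle i a 1 := by
      ext j
      · by_cases h : j = i
        · subst h; simp [cocharEval, idemCochar, torusPtSingle]
        · simp [cocharEval, idemCochar, torusPtSingle, h]
      · simp [cocharEval, idemCochar, torusPtSingle]
    rw [this, torusElt_torusPtSingle, Units.val_one, one_smul]
    rfl
  · have : cocharEval (idemCochar (Sum.inr i)) a = torusPtSingle i a⁻¹ a := by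
      ext j
      · by_cases h : j = i
        · subst h; simp [cocharEval, idemCochar, torusPtSingle]
        · simp [cocharEval, idemCochar, torusPtSingle, h]
      · simp [cocharEval, idemCochar, torusPtSingle]
    have h := bvec_mul_dual_add (K := K) (Sum.inl (Sum.inl i) : Idx g)
    rw [this, torusElt_torusPtSingle, torusFactor]
    simp only [dualIdx] at *
    rw [← eq_sub_iff_add_eq'] at h
    rw [h, smul_add, smul_smul, smul_sub, ← sub_eq_zero]
    have h2' : (2 : Cl g K) = (2 : K) • 1 := by rw [two_smul, one_add_one_eq_two]
    rw [h2', smul_smul, div_mul_cancel₀ _ h2, Units.val_inv_eq_inv_val]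
    -- Since `e'_i e_i = 2 - e_i e'_i`, the torus of `e'_i` is `a` times that of `e_i` at `a⁻¹`;
    -- this is the source of the coordinates `(-ε_i, 1)` of `idemCochar`.
    have e : (a : K) * (((a : K)⁻¹ - 1) / 2) = -(((a : K) - 1) / 2) := by
      field_simp [a.ne_zero]; ring
    rw [e]
    module

theorem torusElt_scalarCochar (n : ℤ) (a : Kˣ) :
    (torusElt (cocharEval ((0, n) : X g) a) : Cl g K) = algebraMap K _ ((a ^ n : Kˣ) : K) := by
  have h1 : ∀ i, torusFactor g K i 1 = 1 := fun i => by ext; simp [torusFactor]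
  have h : torusElt (cocharEval ((0, n) : X g) a) =
      Units.map (algebraMap K (Cl g K) : K →* Cl g K) (a ^ n) := by
    simp [torusElt, cocharEval, h1, List.ofFn_eq_map]
  rw [h]
  rfl

theorem sum_wt_sq (j : Fin g ⊕ Fin g) : ∑ i, (wt (Sum.inl j)).1 i ^ 2 = 1 := by
  rcases j with j | j <;> simp [wt, Pi.single_apply, ite_pow]

theorem sum_wt_mul_wt (j k : Fin g ⊕ Fin g) (hjk : j ≠ k)
    (h : wt (Sum.inl j) + wt (Sum.inl k) ≠ 0) :
    ∑ i, (wt (Sum.inl j)).1 i * (wt (Sum.inl k)).1 i = 0 := by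
  rcases j with j | j <;> rcases k with k | k <;>
    simp [wt, Pi.single_apply] at hjk h ⊢ <;> grind

theorem sum_root_sq (j k : Fin g ⊕ Fin g) (hjk : j ≠ k)
    (h : wt (Sum.inl j) + wt (Sum.inl k) ≠ 0) :
    ∑ i, (wt (Sum.inl j) + wt (Sum.inl k)).1 i ^ 2 = 2 := by
  simp only [Prod.fst_add, Pi.add_apply, add_sq, Finset.sum_add_distrib, sum_wt_sq, mul_assoc,
    ← Finset.mul_sum, sum_wt_mul_wt j k hjk h]
  norm_num

theorem sum_wt_add_idemCochar (j : Fin g ⊕ Fin g) :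
    ∑ i, (wt (Sum.inl j)).1 i = 1 - 2 * (idemCochar j).2 := by
  rcases j with j | j <;> simp [wt, idemCochar]

/-- Let `P = b_j b_{j'} / 2` and `R = b_k b_{k'} / 2`, which are commuting idempotents. Then `a⁻¹ (1
+ (a-1)P)(1 + (a-1)R)` has eigenvalue `a` where both are `1`, `a⁻¹` where both are `0`, and `1`
elsewhere, as the torus of an `SL₂` should. -/
theorem coroot_long (j k : Fin g ⊕ Fin g) (hjk : j ≠ k)
    (h : wt (Sum.inl j) + wt (Sum.inl k) ≠ 0) :
    coroot (wt (Sum.inl j) + wt (Sum.inl k)) = idemCochar j + idemCochar k + (0, -1) := by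
  have hw : ∀ j : Fin g ⊕ Fin g, (wt (Sum.inl j)).1 = (idemCochar j).1 := by
    rintro (j | j) <;> rfl
  rw [coroot, sum_root_sq j k hjk h]
  ext i
  · simp [hw]
  · simp only [Prod.fst_add, Pi.add_apply, Finset.sum_add_distrib, sum_wt_add_idemCochar,
      Prod.snd_add]
    omega

theorem coroot_short (j : Fin g ⊕ Fin g) :
    coroot (wt (Sum.inl j)) = idemCochar j + idemCochar j + (0, -1) := by
  have hw : ∀ j : Fin g ⊕ Fin g, (wt (Sum.inl j)).1 = (idemCochar j).1 := by
    rintro (j | j) <;> rfl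
  rw [coroot, sum_wt_sq]
  ext i
  · simp [hw, two_mul]
  · simp only [sum_wt_add_idemCochar, Prod.snd_add]
    omega

/-- A root is either `wt j + wt k` with `b_j`, `b_k` isotropic and orthogonal, or `wt j` with `b_j`
isotropic. -/
theorem root_cases {β : X g} (hβ : β ∈ roots g) :
    (∃ j k : Fin g ⊕ Fin g, j ≠ k ∧ wt (Sum.inl j) + wt (Sum.inl k) ≠ 0 ∧
      β = wt (Sum.inl j) + wt (Sum.inl k)) ∨ ∃ j : Fin g ⊕ Fin g, β = wt (Sum.inl j) := by
  obtain ⟨j, k, hjk, rfl, h0⟩ := hβ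
  rcases j with j | j <;> rcases k with k | k
  · exact Or.inl ⟨j, k, fun h => hjk (by rw [h]), h0, rfl⟩
  · exact Or.inr ⟨j, add_zero _⟩
  · exact Or.inr ⟨k, zero_add _⟩
  · exact absurd rfl hjk

theorem pair_eq_coroot (χ : X g) {β : X g} (hβ : β ∈ roots g) :
    pair χ β = ((∑ i, χ.1 i * (coroot β).1 i + χ.2 * (coroot β).2 : ℤ) : ℚ) := by
  obtain ⟨N, hN0, hN, hc, hz⟩ : ∃ N : ℤ, N ≠ 0 ∧ ∑ i, β.1 i ^ 2 = N ∧
      (∀ i, N * (coroot β).1 i = 2 * β.1 i) ∧ N * (coroot β).2 = -∑ i, β.1 i := by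
    rcases root_cases hβ with ⟨j, k, hjk, h, rfl⟩ | ⟨j, rfl⟩
    · refine ⟨2, two_ne_zero, sum_root_sq j k hjk h, ?_, ?_⟩
      · intro i; rw [coroot, sum_root_sq j k hjk h]; dsimp only; omega
      · rw [coroot_long j k hjk h]
        simp only [Prod.fst_add, Pi.add_apply, Finset.sum_add_distrib, sum_wt_add_idemCochar,
          Prod.snd_add]
        ring
    · refine ⟨1, one_ne_zero, sum_wt_sq j, ?_, ?_⟩
      · intro i; rw [coroot, sum_wt_sq]; dsimp only; omega
      · rw [coroot, sum_wt_sq]; dsimp only; omega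
  have hN' : ((N : ℤ) : ℚ) ≠ 0 := by exact_mod_cast hN0
  have hc' : ∀ i, 2 * (β.1 i : ℚ) = N * ((coroot β).1 i : ℚ) := fun i => by exact_mod_cast (hc i).symm
  have hz' : (N : ℚ) * ((coroot β).2 : ℚ) = -∑ i, (β.1 i : ℚ) := by exact_mod_cast hz
  have hs : ∑ i, (β.1 i : ℚ) ^ 2 = N := by exact_mod_cast hN
  rw [pair, hs, div_eq_iff hN']
  push_cast
  rw [add_mul, Finset.sum_mul, mul_assoc (χ.2 : ℚ), mul_comm _ (N : ℚ), hz', mul_neg,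
    Finset.mul_sum, Finset.mul_sum, ← sub_eq_add_neg, ← Finset.sum_sub_distrib]
  refine Finset.sum_congr rfl fun i _ => ?_
  linear_combination (χ.1 i : ℚ) * hc' i

/-- Restriction of a character to the image of a coroot. -/
theorem charEval_coroot (χ : X g) {β : X g} (hβ : β ∈ roots g) {m : ℤ} (hm : pair χ β = m)
    (a : Kˣ) : charEval χ (cocharEval (coroot β) a) = a ^ m := by
  rw [charEval_cocharEval]
  congr 1
  rw [pair_eq_coroot χ hβ] at hm
  exact_mod_cast hm

end Coroot

/-! ### The `SL₂` attached to a root -/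

section SL2

variable {K A : Type*} [Field K] [Ring A] [Algebra K A]

/-- The commutation relation between the two unipotent subgroups of `SL₂`. -/
theorem unipotent_commutation {E F : A} (hE : E * E = 0) (hF : F * F = 0) (hEFE : E * F * E = E)
    (hFEF : F * E * F = F) {s a : K} (ha : a = 1 + s) (ha0 : a ≠ 0) :
    (1 + E) * (1 + s • F) = (1 + (s / a) • F) * (1 + (a - 1) • (E * F) + (a⁻¹ - 1) • (F * E)) *
      (1 + a⁻¹ • E) := by
  -- This is the factorization of `[1 1; 0 1][1 0; s 1]` as lower times diagonal times upper. `EF +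
  -- FE` need not be `1`, so it is checked by expansion in the algebra.
  have h1 : F * (F * E) = 0 := by rw [← mul_assoc, hF, zero_mul]
  have h2 : F * (E * F) = F := by rw [← mul_assoc, hFEF]
  have h3 : F * E * E = 0 := by rw [mul_assoc, hE, mul_zero]
  have e1 : (1 + (s / a) • F) * (1 + (a - 1) • (E * F) + (a⁻¹ - 1) • (F * E)) =
      (1 + (a - 1) • (E * F) + (a⁻¹ - 1) • (F * E)) + s • F := by
    simp only [add_mul, mul_add, one_mul, mul_one, smul_mul_smul_comm, h1, h2, smul_zero,
      add_zero]
    have : s • F = (s / a) • F + (s / a * (a - 1)) • F := by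
      rw [← add_smul]; congr 1; field_simp; ring
    rw [this]; abel
  have e2 : a⁻¹ • E + ((a - 1) * a⁻¹) • E = E := by
    rw [← add_smul]
    have : a⁻¹ + (a - 1) * a⁻¹ = 1 := by field_simp; ring
    rw [this, one_smul]
  have e3 : (a⁻¹ - 1) • (F * E) + (s * a⁻¹) • (F * E) = 0 := by
    rw [← add_smul]
    have : a⁻¹ - 1 + s * a⁻¹ = 0 := by rw [ha] at ha0 ⊢; field_simp; ring
    rw [this, zero_smul]
  have e4 : a - 1 = s := by rw [ha]; ring
  rw [e1]
  calc (1 + E) * (1 + s • F) = 1 + s • F + E + (a - 1) • (E * F) := by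
        rw [e4]; simp only [add_mul, mul_add, one_mul, mul_one, mul_smul_comm, smul_add]; abel
    _ = 1 + s • F + (a⁻¹ • E + ((a - 1) * a⁻¹) • E) + (a - 1) • (E * F) +
          ((a⁻¹ - 1) • (F * E) + (s * a⁻¹) • (F * E)) := by rw [e2, e3, add_zero]
    _ = _ := by
        simp only [add_mul, mul_add, one_mul, mul_one, smul_mul_smul_comm, hEFE, h3, smul_zero,
          add_zero]
        abel

end SL2

section RootSL2

variable {g : ℕ} {K : Type*} [Field K]

/-- Root vectors `E` and `F` for `β` and `-β`, normalized so that they span an `SL₂` with torus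
the coroot of `β`. -/
structure IsRootTriple (β : X g) (E F : Cl g K) : Prop where
  isRootElt_left : ∀ (s : K) (u : (Cl g K)ˣ), (u : Cl g K) = 1 + s • E → IsRootElt β u
  isRootElt_right : ∀ (s : K) (u : (Cl g K)ˣ), (u : Cl g K) = 1 + s • F → IsRootElt (-β) u
  left_sq : E * E = 0
  right_sq : F * F = 0
  mul_left : E * F * E = E
  mul_right : F * E * F = F
  torusElt_coroot : ∀ a : Kˣ, (torusElt (cocharEval (coroot β) a) : Cl g K) =
    1 + ((a : K) - 1) • (E * F) + ((a : K)⁻¹ - 1) • (F * E)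
  torusElt_mul : ∀ t : TorusPt g K, (torusElt t : Cl g K) * F =
    (charEval (-β) t : K) • (F * (torusElt t : Cl g K))

/-- The two hyperbolic pairs anticommute with each other, so quadratic words in one commute with the
other and each product splits into a factor for each pair. The constant `4` is one factor `2` from
each relation `z z' z = 2 z`. -/
theorem four_anticomm_rels {A : Type*} [Ring A] [Algebra K A]
    {x x' y y' : A} (hx : x * x = 0) (hx' : x' * x' = 0) (hy : y * y = 0)
    (hy' : y' * y' = 0) (hxx : x * x' + x' * x = 2) (hyy : y * y' + y' * y = 2)
    (h1 : y * x = -(x * y)) (h3 : y * x' = -(x' * y)) (h4 : y' * x = -(x * y'))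
    (h5 : y' * x' = -(x' * y')) :
    (x * y) * (x * y) = 0 ∧ (y' * x') * (y' * x') = 0 ∧
    (x * y) * (y' * x') = (x * x') * (y * y') ∧ (y' * x') * (x * y) = (x' * x) * (y' * y) ∧
    (x * y) * (y' * x') * (x * y) = (4 : K) • (x * y) ∧
    (y' * x') * (x * y) * (y' * x') = (4 : K) • (y' * x') := by
  have comm : ∀ {a b z : A}, a * z = -(z * a) → b * z = -(z * b) → a * b * z = z * (a * b) :=
    fun {a b z} ha hb => by rw [mul_assoc, hb, mul_neg, ← mul_assoc, ha, neg_mul, neg_neg, mul_assoc]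
  have c : ∀ {z z' : A}, z * z = 0 → z * z' + z' * z = 2 → z * z' * z = 2 * z :=
    fun {z z'} hz hzz => by
      have : z' * z = 2 - z * z' := by rw [← hzz]; abel
      rw [mul_assoc, this, mul_sub, ← mul_assoc, hz, zero_mul, sub_zero, mul_two, two_mul]
  have four : ∀ z w : A, 2 * z * 2 * w = (4 : K) • (z * w) := fun z w => by
    rw [Algebra.smul_def, map_ofNat]; noncomm_ring
  have e : (x * y) * (y' * x') = (x * x') * (y * y') := by
    rw [mul_assoc, ← mul_assoc y, comm h3 h5]; simp only [mul_assoc]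
  have e' : (y' * x') * (x * y) = (x' * x) * (y' * y) := by
    rw [mul_assoc, ← mul_assoc x', ← mul_assoc, ← mul_assoc (x' * x),
      comm (neg_eq_iff_eq_neg.2 h5).symm (neg_eq_iff_eq_neg.2 h4).symm]
  refine ⟨?_, ?_, e, e', ?_, ?_⟩
  · rw [mul_assoc, ← mul_assoc y, h1, neg_mul, mul_neg, ← mul_assoc, ← mul_assoc, hx]; simp
  · rw [mul_assoc, ← mul_assoc x', ← neg_eq_iff_eq_neg.2 h5, neg_mul, mul_neg, ← mul_assoc,
      ← mul_assoc, hy']; simp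
  · rw [e, mul_assoc, ← mul_assoc (y * y'), comm h1 h4, mul_assoc x (y * y'), c hy hyy, ← mul_assoc,
      ← mul_assoc, c hx hxx, four]
  · have hyy' : y' * y + y * y' = 2 := by rw [← hyy, add_comm]
    have hxx' : x' * x + x * x' = 2 := by rw [← hxx, add_comm]
    rw [e', h5, mul_neg, smul_neg, mul_assoc, ← mul_assoc (y' * y), comm h5 h3, mul_assoc x' (y' * y),
      c hy' hyy', ← mul_assoc, ← mul_assoc, c hx' hxx', four]

theorem isRootElt_of_smul {β : X g} (j k : Idx g) (hjk : j ≠ k) (hβ : wt j + wt k = β) (c : K)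
    (s : K) (u : (Cl g K)ˣ) (hu : (u : Cl g K) = 1 + s • c • (bvec g K j * bvec g K k)) :
    IsRootElt β u :=
  ⟨j, k, s * c, hjk, hβ, by rw [hu, smul_smul]⟩

theorem dualIdx_injective : Function.Injective (dualIdx : Idx g → Idx g) :=
  Function.LeftInverse.injective (g := dualIdx) (by rintro ((j | j) | j) <;> rfl)

/-- For a long root the triple is `E = b_j b_k`, `F = b_{k'} b_{j'} / 4`; for a short one it is `E =
b_j e_0`, `F = e_0 b_{j'} / 2`. The scalars are forced by `E F E = E`. -/
theorem exists_isRootTriple (h2 : (2 : K) ≠ 0) {β : X g} (hβ : β ∈ roots g) :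
    ∃ E F : Cl g K, IsRootTriple β E F := by
  have two_smul_one : (2 : Cl g K) = (2 : K) • 1 := by rw [two_smul, one_add_one_eq_two]
  rcases root_cases hβ with ⟨j, k, hjk, h0, rfl⟩ | ⟨j, rfl⟩
  · have hk : (Sum.inl k : Idx g) ≠ dualIdx (Sum.inl j) := fun h => h0 (by
      rw [h, wt_dualIdx, add_neg_cancel])
    have hjk' : (Sum.inl j : Idx g) ≠ Sum.inl k := fun h => hjk (Sum.inl_injective h)
    have hd : ∀ j : Idx g, dualIdx (dualIdx j) = j := by rintro ((j | j) | j) <;> rfl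
    have hsq : ∀ j : Fin g ⊕ Fin g,
        bvec g K (dualIdx (Sum.inl j)) * bvec g K (dualIdx (Sum.inl j)) = 0 := by
      rintro (j | j) <;> exact bvec_sq_inl _
    obtain ⟨r1, r2, r3, r4, r5, r6⟩ := four_anticomm_rels (K := K)
      (bvec_sq_inl (K := K) j) (hsq j) (bvec_sq_inl k) (hsq k)
      (bvec_mul_dual_add _) (bvec_mul_dual_add _)
      (bvec_mul_bvec_swap _ _ hk)
      (bvec_mul_bvec_swap _ _ (by rw [hd]; exact hjk'.symm))
      (bvec_mul_bvec_swap _ _ (fun h => hjk' (dualIdx_injective h).symm))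
      (bvec_mul_bvec_swap _ _ (fun h => hk (by rw [← hd (Sum.inl k), h, hd])))
    have hx := bvec_mul_dual_add (K := K) (Sum.inl j)
    have hy := bvec_mul_dual_add (K := K) (Sum.inl k)
    rw [← eq_sub_iff_add_eq'] at hx hy
    have h4 : (4 : K) ≠ 0 := by
      rw [show (4 : K) = 2 * 2 by norm_num]; exact mul_ne_zero h2 h2
    have hneg : wt (dualIdx (Sum.inl k)) + wt (dualIdx (Sum.inl j)) =
        -(wt (Sum.inl j) + wt (Sum.inl k) : X g) := by
      rw [wt_dualIdx, wt_dualIdx, neg_add, add_comm]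
    refine ⟨bvec g K (Sum.inl j) * bvec g K (Sum.inl k),
      (1 / 4 : K) • (bvec g K (dualIdx (Sum.inl k)) * bvec g K (dualIdx (Sum.inl j))),
      ⟨fun s u hu => ⟨_, _, s, hjk', rfl, hu⟩, isRootElt_of_smul _ _
        (fun h => hjk' (dualIdx_injective h).symm) hneg _, r1, ?_, ?_, ?_, ?_, ?_⟩⟩
    · rw [smul_mul_smul_comm, r2, smul_zero]
    · rw [mul_smul_comm, smul_mul_assoc, r5, smul_smul, one_div_mul_cancel h4, one_smul]
    · rw [smul_mul_assoc, smul_mul_smul_comm, r6, smul_smul]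
      congr 1; field_simp
    · intro a
      rw [coroot_long j k hjk h0, cocharEval_add, cocharEval_add, SpinLemma.torusElt_mul h2,
        SpinLemma.torusElt_mul h2, Units.val_mul, Units.val_mul, torusElt_idemCochar h2,
        torusElt_idemCochar h2, torusElt_scalarCochar, mul_smul_comm, smul_mul_assoc, r3, r4,
        hx, hy]
      generalize bvec g K (Sum.inl j) * bvec g K (dualIdx (Sum.inl j)) = p
      generalize bvec g K (Sum.inl k) * bvec g K (dualIdx (Sum.inl k)) = r
      rw [← Algebra.commutes, ← Algebra.smul_def, two_smul_one]
      simp only [mul_add, add_mul, sub_mul, mul_sub, one_mul, mul_one, smul_mul_smul_comm,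
        smul_mul_assoc, mul_smul_comm, zpow_neg, zpow_one, Units.val_inv_eq_inv_val]
      have ha := a.ne_zero
      match_scalars <;> field_simp <;> ring
    · intro t
      rw [mul_smul_comm, torusElt_mul_bvec_mul_bvec h2, hneg, smul_comm, smul_mul_assoc]
  · have hd : dualIdx (dualIdx (Sum.inl j) : Idx g) = Sum.inl j := by rcases j with j | j <;> rfl
    have hj0 : (dualIdx (Sum.inl j) : Idx g) ≠ Sum.inr () := by
      rcases j with j | j <;> simp [dualIdx]
    have hsq' : bvec g K (dualIdx (Sum.inl j)) * bvec g K (dualIdx (Sum.inl j)) = 0 := by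
      rcases j with j | j <;> exact bvec_sq_inl _
    have hx := bvec_mul_dual_add (K := K) (Sum.inl j)
    have hsq := bvec_sq_inl (K := K) j
    have hz := bvec_sq_inr (g := g) (K := K)
    have hzx := bvec_mul_bvec_swap (K := K) (Sum.inl j) (Sum.inr ()) hj0.symm
    have hzx' := bvec_mul_bvec_swap (K := K) (dualIdx (Sum.inl j)) (Sum.inr ()) (by simp [hd])
    have hneg : wt (Sum.inr ()) + wt (dualIdx (Sum.inl j)) = -(wt (Sum.inl j) : X g) := by
      rw [wt_dualIdx]; exact zero_add _
    -- The short coroot is `a⁻¹ (1 + (a-1)P)²` with `P` the idempotent `b_j b_{j'} / 2`; it has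
    -- eigenvalues `a` and `a⁻¹`.
    have htor : ∀ a : Kˣ, (torusElt (cocharEval (coroot (wt (Sum.inl j))) a) : Cl g K) =
        (a⁻¹ : K) • ((1 + (((a : K) - 1) / 2) •
          (bvec g K (Sum.inl j) * bvec g K (dualIdx (Sum.inl j)))) *
          (1 + (((a : K) - 1) / 2) •
          (bvec g K (Sum.inl j) * bvec g K (dualIdx (Sum.inl j))))) := by
      intro a
      rw [coroot_short j, cocharEval_add, cocharEval_add, SpinLemma.torusElt_mul h2,
        SpinLemma.torusElt_mul h2, Units.val_mul, Units.val_mul, torusElt_idemCochar h2,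
        torusElt_scalarCochar, ← Algebra.commutes, ← Algebra.smul_def, zpow_neg, zpow_one,
        Units.val_inv_eq_inv_val]
    have htm : ∀ t : TorusPt g K, (torusElt t : Cl g K) *
        (bvec g K (Sum.inr ()) * bvec g K (dualIdx (Sum.inl j))) =
        (charEval (-(wt (Sum.inl j) : X g)) t : K) •
        (bvec g K (Sum.inr ()) * bvec g K (dualIdx (Sum.inl j)) * (torusElt t : Cl g K)) := by
      intro t
      rw [torusElt_mul_bvec_mul_bvec h2, hneg]
    refine ⟨bvec g K (Sum.inl j) * bvec g K (Sum.inr ()),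
      (1 / 2 : K) • (bvec g K (Sum.inr ()) * bvec g K (dualIdx (Sum.inl j))),
      ⟨fun s u hu => ⟨_, _, s, by simp, add_zero _, hu⟩,
        isRootElt_of_smul _ _ hj0.symm hneg _, ?_, ?_, ?_, ?_, ?_, ?_⟩⟩
    all_goals
      generalize bvec g K (Sum.inr ()) = z at *
      generalize bvec g K (dualIdx (Sum.inl j)) = x' at *
      generalize bvec g K (Sum.inl j) = x at *
    all_goals
      have hx'x : x' * x = 2 - x * x' := by rw [← hx]; abel
      have hxx'x : x * x' * x = (2 : K) • x := by
        rw [mul_assoc, hx'x, mul_sub, ← mul_assoc, hsq, zero_mul, sub_zero, mul_two, two_smul]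
      have hx'xx' : x' * x * x' = (2 : K) • x' := by
        rw [hx'x, sub_mul, mul_assoc, hsq', mul_zero, sub_zero, two_mul, two_smul]
      have hEF : x * z * (z * x') = x * x' := by
        rw [mul_assoc, ← mul_assoc z, hz, one_mul]
      have hFE : z * x' * (x * z) = x' * x := by
        rw [hzx', neg_mul, mul_assoc, ← mul_assoc z, hzx, neg_mul, mul_assoc, hz, mul_one, mul_neg,
          neg_neg]
    · rw [mul_assoc, ← mul_assoc z, hzx, neg_mul, mul_neg, ← mul_assoc, ← mul_assoc, hsq]; simp
    · rw [smul_mul_smul_comm, mul_assoc, ← mul_assoc x', ← neg_eq_iff_eq_neg.2 hzx', neg_mul,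
        mul_neg, mul_assoc, hsq']
      simp
    · rw [mul_smul_comm, smul_mul_assoc, hEF, ← mul_assoc, hxx'x, smul_mul_assoc, smul_smul,
        one_div_mul_cancel h2, one_smul]
    · rw [smul_mul_assoc, smul_mul_smul_comm, hFE, hzx', mul_neg, ← mul_assoc, hx'xx',
        smul_mul_assoc, ← smul_neg, smul_smul]
      congr 1; field_simp
    · intro a
      rw [htor, mul_smul_comm, smul_mul_assoc, hEF, hFE, hx'x]
      have hpp : x * x' * (x * x') = (2 : K) • (x * x') := by
        rw [← mul_assoc, hxx'x, smul_mul_assoc]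
      generalize x * x' = p at *
      rw [two_smul_one]
      simp only [mul_add, add_mul, one_mul, mul_one, smul_mul_smul_comm, smul_mul_assoc,
        mul_smul_comm, hpp]
      have ha := a.ne_zero
      match_scalars <;> field_simp <;> ring
    · intro t
      rw [mul_smul_comm, htm, smul_comm, smul_mul_assoc]

end RootSL2
end SpinLemma

namespace SpinLemma
open CliffordAlgebra

/-! ### Lowering a highest weight vector -/

section Unipotent

variable {g : ℕ} {K : Type*} [Field K]

/-- The unit `1 + s F` for `F² = 0`. -/
def unipotentUnit (F : Cl g K) (hF : F * F = 0) (s : K) : (Cl g K)ˣ where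
  val := 1 + s • F
  inv := 1 + (-s) • F
  val_inv := by
    simp only [mul_add, add_mul, mul_one, one_mul, smul_mul_smul_comm, hF, smul_zero]
    module
  inv_val := by
    simp only [mul_add, add_mul, mul_one, one_mul, smul_mul_smul_comm, hF, smul_zero]
    module

/-- Both `1 + sF` and its inverse `1 - sF` are affine in `s`, so the generators restrict to
polynomials. -/
theorem regularFunctions_unipotentUnit {k : Type*} [Field k] [Algebra k K] (F : Cl g K)
    (hF : F * F = 0) {f : (Cl g K)ˣ → K} (hf : f ∈ regularFunctions g k K) :
    ∃ p : Polynomial K, ∀ s, f (unipotentUnit F hF s) = p.eval s := by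
  induction hf using Algebra.adjoin_induction with
  | mem f hf =>
    obtain ⟨φ, _, rfl | rfl⟩ := hf
    · refine ⟨.C (φ 1) + .C (φ F) * .X, fun s => ?_⟩
      simp only [unipotentUnit, map_add, map_smul, Polynomial.eval_add, Polynomial.eval_mul,
        Polynomial.eval_C, Polynomial.eval_X, smul_eq_mul, mul_comm]
    · refine ⟨.C (φ 1) - .C (φ F) * .X, fun s => ?_⟩
      simp only [unipotentUnit, Units.inv_mk, map_add, map_smul, Polynomial.eval_sub,
        Polynomial.eval_mul, Polynomial.eval_C, Polynomial.eval_X, smul_eq_mul]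
      ring
  | algebraMap r => exact ⟨.C (algebraMap k K r), fun s => by simp⟩
  | add f f' _ _ h h' =>
    obtain ⟨p, hp⟩ := h
    obtain ⟨p', hp'⟩ := h'
    exact ⟨p + p', fun s => by simp [hp, hp']⟩
  | mul f f' _ _ h h' =>
    obtain ⟨p, hp⟩ := h
    obtain ⟨p', hp'⟩ := h'
    exact ⟨p * p', fun s => by simp [hp, hp']⟩

/-- The homogenization `∑ c_i X^i (1 + X)^(N - i)` of a polynomial. -/
theorem exists_homogenization (p : Polynomial K) {N : ℕ} (hN : p.natDegree ≤ N) :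
    ∃ Q : Polynomial K, Q.coeff 0 = p.coeff 0 ∧ Q.coeff 1 = N * p.coeff 0 + p.coeff 1 ∧
      ∀ s : K, 1 + s ≠ 0 → Q.eval s = (1 + s) ^ N * p.eval (s / (1 + s)) := by
  have hX : ∀ r : ℕ, ((1 + Polynomial.X : Polynomial K) ^ r).coeff 0 = 1 ∧
      ((1 + Polynomial.X : Polynomial K) ^ r).coeff 1 = r := fun r => by
    simp [Polynomial.coeff_one_add_X_pow]
  refine ⟨∑ i ∈ Finset.range (N + 1), .C (p.coeff i) * (.X ^ i * (1 + .X) ^ (N - i)), ?_, ?_,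
    fun s hs => ?_⟩
  · rw [Finset.sum_range_succ', Polynomial.coeff_add, Polynomial.finsetSum_coeff,
      Finset.sum_eq_zero]
    · simp [(hX _).1]
    · intro i _
      rw [Polynomial.coeff_C_mul, Polynomial.coeff_X_pow_mul', if_neg (by omega), mul_zero]
  -- Only the terms `i = 0` and `i = 1` reach degree one. For `N = 0` the second is missing, but
  -- then `p` is constant.
  · rcases N with - | N
    · have : p.coeff 1 = 0 := Polynomial.coeff_eq_zero_of_natDegree_lt (by omega)
      simp [this]
    · rw [Finset.sum_range_succ', Finset.sum_range_succ', Polynomial.coeff_add,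
        Polynomial.coeff_add, Polynomial.finsetSum_coeff, Finset.sum_eq_zero]
      · rw [Polynomial.coeff_C_mul, Polynomial.coeff_X_pow_mul', if_pos le_rfl, zero_add,
          Polynomial.coeff_C_mul, Polynomial.coeff_X_pow_mul', if_pos zero_le_one, Nat.sub_self,
          (hX _).1, Nat.sub_zero, (hX _).2]
        simp; ring
      · intro i _
        rw [Polynomial.coeff_C_mul, Polynomial.coeff_X_pow_mul', if_neg (by omega), mul_zero]
  · rw [Polynomial.eval_finsetSum, Polynomial.eval_eq_sum_range' (Nat.lt_succ_of_le hN),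
      Finset.mul_sum]
    refine Finset.sum_congr rfl fun i hi => ?_
    have hi' : i ≤ N := Nat.lt_succ_iff.1 (Finset.mem_range.1 hi)
    simp only [Polynomial.eval_mul, Polynomial.eval_pow, Polynomial.eval_add,
      Polynomial.eval_one, Polynomial.eval_X, Polynomial.eval_C, div_pow]
    rw [← Nat.sub_add_cancel hi', pow_add (1 + s) (N - i) i, Nat.add_sub_cancel]
    field_simp

end Unipotent

section Weights

variable {g : ℕ} {k : Type*} [Field k] {Φ : Set (X g)} {n : ℕ}

local notation "k̄" => AlgebraicClosure k

/-- This is the relation `E F x = m x` without a Lie algebra action. Let `p(s)` be the orbit map of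
`U_{-β}` through `x`; its linear coefficient plays the role of `F x`. Applying the `SL₂`
factorization to `x`, which `U_β` fixes, gives `u_E(1) p(s) = (1+s)^m p(s/(1+s))`. If the linear
coefficient vanished, comparison in degree one would give `m x = 0`. Conjugation by the torus shows
that this coefficient has weight `μ - β`. -/
theorem RatRep.sub_mem_weights (h2 : (2 : k) ≠ 0) (ρ : RatRep g k Φ n) {β μ : X g}
    (hβ : β ∈ Φ) (hβ' : -β ∈ Φ) (hβr : β ∈ roots g) {x : Fin n → k̄} (hx0 : x ≠ 0)
    (hx : ρ.IsWeightVec μ x)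
    (hfix : ∀ h : H0 g k̄ Φ, IsRootElt β (h : (Cl g k̄)ˣ) → (ρ.toHom h).mulVec x = x)
    {m : ℕ} (hm : pair μ β = m) (hmk : (m : k) ≠ 0) : μ - β ∈ ρ.weights := by
  have h2' : (2 : k̄) ≠ 0 := fun h => h2 ((algebraMap k k̄).injective (by rw [map_ofNat, map_zero, h]))
  have hmK : (m : k̄) ≠ 0 := fun h => hmk ((algebraMap k k̄).injective (by simpa using h))
  obtain ⟨E, F, hEF⟩ := exists_isRootTriple h2' hβr
  let uE : k̄ → H0 g k̄ Φ := fun s => ⟨unipotentUnit E hEF.left_sq s,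
    Subgroup.subset_closure (Or.inr ⟨β, hβ, hEF.isRootElt_left s _ rfl⟩)⟩
  let uF : k̄ → H0 g k̄ Φ := fun s => ⟨unipotentUnit F hEF.right_sq s,
    Subgroup.subset_closure (Or.inr ⟨-β, hβ', hEF.isRootElt_right s _ rfl⟩)⟩
  let T : TorusPt g k̄ → H0 g k̄ Φ := fun t => ⟨torusElt t, torusElt_mem Φ t⟩
  have hfixE : ∀ s, (ρ.toHom (uE s)).mulVec x = x := fun s =>
    hfix _ (hEF.isRootElt_left s _ rfl)
  -- the coordinates of the orbit map of `U_{-β}` are polynomial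
  have hpoly : ∀ i, ∃ p : Polynomial k̄, ∀ s, (ρ.toHom (uF s)).mulVec x i = p.eval s := by
    intro i
    have h1 : ∀ j, ∃ p : Polynomial k̄, ∀ s, ρ.toHom (uF s) i j = p.eval s := fun j => by
      obtain ⟨f, hf, hfe⟩ := ρ.regular i j
      obtain ⟨p, hp⟩ := regularFunctions_unipotentUnit F hEF.right_sq hf
      exact ⟨p, fun s => by rw [hfe, hp]⟩
    choose p hp using h1
    refine ⟨∑ j, p j * .C (x j), fun s => ?_⟩
    simp [Matrix.mulVec, dotProduct, hp, Polynomial.eval_finsetSum]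
  choose p hp using hpoly
  have hp0 : ∀ i, (p i).coeff 0 = x i := fun i => by
    rw [Polynomial.coeff_zero_eq_eval_zero, ← hp]
    have : uF 0 = 1 := Subtype.ext (Units.ext (by simp [uF, unipotentUnit]))
    rw [this, map_one, Matrix.one_mulVec]
  refine ⟨fun i => (p i).coeff 1, fun h1 => ?_, fun t => ?_⟩
  · have hcomm : ∀ s (hs : 1 + s ≠ 0), uE 1 * uF s =
        uF (s / (1 + s)) * T (cocharEval (coroot β) (Units.mk0 _ hs)) * uE (1 + s)⁻¹ := by
      intro s hs
      refine Subtype.ext (Units.ext ?_)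
      have := unipotent_commutation hEF.left_sq hEF.right_sq hEF.mul_left hEF.mul_right
        (s := s) rfl hs
      simp only [uE, uF, T, unipotentUnit, Subgroup.coe_mul, Units.val_mul,
        hEF.torusElt_coroot, one_smul, Units.val_mk0]
      exact this
    have hrel : ∀ i s, 1 + s ≠ 0 → ∑ j, ρ.toHom (uE 1) i j * (p j).eval s =
        (1 + s) ^ m * (p i).eval (s / (1 + s)) := by
      intro i s hs
      have h := congrArg (fun h => (ρ.toHom h).mulVec x i) (hcomm s hs)
      simp only [map_mul, ← Matrix.mulVec_mulVec, hfixE] at h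
      rw [hx, charEval_coroot μ hβr (m := m) (by simpa using hm), Matrix.mulVec_smul,
        Pi.smul_apply, hp, zpow_natCast, Units.val_pow_eq_pow_val, Units.val_mk0, smul_eq_mul] at h
      rw [← h, Matrix.mulVec, dotProduct]
      simp only [hp]
    -- A common degree bound, so that a single power of `1 + s` clears the denominators of all
    -- coordinates.
    set N := Finset.univ.sup fun i => (p i).natDegree with hN
    apply hx0
    funext i
    obtain ⟨Q, hQ0, hQ1, hQ⟩ := exists_homogenization (p i) (N := N)
      (Finset.le_sup (f := fun i => (p i).natDegree) (Finset.mem_univ i))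
    -- The identity holds for all `s ≠ -1`, an infinite set, hence between polynomials.
    have hpol : (1 + .X) ^ N * ∑ j, .C (ρ.toHom (uE 1) i j) * p j = (1 + .X) ^ m * Q := by
      refine Polynomial.eq_of_infinite_eval_eq _ _ (Set.Infinite.mono (s := {-1}ᶜ) ?_ ?_)
      · intro s hs
        have hs' : 1 + s ≠ 0 := fun h => hs (by
          rw [Set.mem_singleton_iff]; linear_combination h)
        simp only [Set.mem_ofPred_eq, Polynomial.eval_mul, Polynomial.eval_pow, Polynomial.eval_add,
          Polynomial.eval_one, Polynomial.eval_X, Polynomial.eval_finsetSum, Polynomial.eval_C,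
          hrel i s hs', hQ s hs']
        ring
      · exact (Set.finite_singleton _).infinite_compl
    have hsum : ∑ j, ρ.toHom (uE 1) i j * x j = x i := congrFun (hfixE 1) i
    have hp1 : ∀ j, (p j).coeff 1 = 0 := fun j => congrFun h1 j
    -- In degree one the left side gives `N x_i` and the right side `m x_i + N x_i`.
    have hc := congrArg (fun P => Polynomial.coeff P 1) hpol
    have hX : ∀ r : ℕ, ((1 + Polynomial.X : Polynomial k̄) ^ r).coeff 0 = 1 ∧
        ((1 + Polynomial.X : Polynomial k̄) ^ r).coeff 1 = r := fun r => by
      simp [Polynomial.coeff_one_add_X_pow]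
    rw [Polynomial.mul_coeff_one, Polynomial.mul_coeff_one] at hc
    simp only [(hX _).1, (hX _).2, Polynomial.finsetSum_coeff,
      Polynomial.coeff_C_mul, hp0, hp1, hsum, hQ0, hQ1, mul_zero, Finset.sum_const_zero] at hc
    have : (m : k̄) * x i = 0 := by linear_combination -hc
    simpa [hmK] using this
  · set b : k̄ := (charEval (-β) t : k̄)
    -- The torus scales the parameter of `U_{-β}` by `b`, so the coefficient of `s` acquires the
    -- factor `b`, in addition to `μ(t)` from `x`.
    have hconj : ∀ s, T t * uF s = uF (s * b) * T t := by
      intro s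
      refine Subtype.ext (Units.ext ?_)
      simp only [uF, T, unipotentUnit, Subgroup.coe_mul, Units.val_mul, mul_add, add_mul, mul_one,
        one_mul, mul_smul_comm, smul_mul_assoc, hEF.torusElt_mul, smul_smul, b]
    have hpol : ∀ i, ∑ j, .C (ρ.toHom (T t) i j) * p j =
        .C (charEval μ t : k̄) * (p i).comp (.C b * .X) := by
      intro i
      refine Polynomial.funext fun s => ?_
      have h := congrArg (fun h => (ρ.toHom h).mulVec x i) (hconj s)
      simp only [map_mul, ← Matrix.mulVec_mulVec] at h
      rw [hx t, Matrix.mulVec_smul, Pi.smul_apply, hp, smul_eq_mul] at h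
      simp only [Polynomial.eval_finsetSum, Polynomial.eval_mul, Polynomial.eval_C,
        Polynomial.eval_comp, Polynomial.eval_X, mul_comm b, ← h]
      rw [Matrix.mulVec, dotProduct]
      simp only [hp]
    funext i
    have hc := congrArg (fun P => Polynomial.coeff P 1) (hpol i)
    simp only [Polynomial.finsetSum_coeff, Polynomial.coeff_C_mul,
      Polynomial.comp_C_mul_X_coeff, pow_one] at hc
    rw [Pi.smul_apply, smul_eq_mul, sub_eq_add_neg, charEval_add, Units.val_mul]
    change ∑ j, ρ.toHom (T t) i j * (p j).coeff 1 = _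
    rw [hc]
    ring

end Weights
end SpinLemma

namespace SpinLemma
open CliffordAlgebra

/-! ### Weights of the spin representation, orthogonality, and the lattice `X'` -/

section SpinWeights

variable {g : ℕ}

theorem eq_zero_of_forall_zpow_eq_one {K : Type*} [Field K] [Infinite K] {m : ℤ}
    (h : ∀ a : Kˣ, a ^ m = 1) : m = 0 := by
  -- The extra factor `x` makes the equation hold at `0` as well, so it becomes a polynomial
  -- identity.
  have h1 : ∀ x : K, x ^ (m.natAbs + 1) = x := fun x => by
    rcases eq_or_ne x 0 with rfl | hx
    · simp
    · have h2 : (Units.mk0 x hx) ^ m.natAbs = 1 := by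
        rcases Int.natAbs_eq m with hm | hm
        · rw [← zpow_natCast, ← hm]; exact h _
        · rw [← zpow_natCast, ← inv_inj, ← zpow_neg, ← hm, h, inv_one]
      have h3 := congrArg Units.val h2
      rw [Units.val_pow_eq_pow_val, Units.val_mk0, Units.val_one] at h3
      rw [pow_succ, h3, one_mul]
  have h2 : (Polynomial.X : Polynomial K) ^ (m.natAbs + 1) = Polynomial.X :=
    Polynomial.funext fun x => by simpa using h1 x
  have h3 := congrArg Polynomial.natDegree h2
  rw [Polynomial.natDegree_X_pow, Polynomial.natDegree_X] at h3
  omega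

/-- The coordinates of the weights of the spin representation. -/
theorem coords_of_mem_spinWeights {k : Type*} [Field k] (h2 : (2 : k) ≠ 0) {χ : X g}
    (hχ : χ ∈ spinWeights g k) : χ.2 = 1 ∧ ∀ i, χ.1 i = 0 ∨ χ.1 i = 1 := by
  set K := AlgebraicClosure k
  have h2' : (2 : K) ≠ 0 := fun h => h2 ((algebraMap k K).injective (by
    rw [map_ofNat, map_zero, h]))
  obtain ⟨y, hy0, hy⟩ := hχ
  have inj : ∀ {z : ExteriorAlgebra K (Fin g → K)}, z ≠ 0 → ∀ {a b : Kˣ},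
      (a : K) • z = (b : K) • z → a = b := fun hz a b h =>
    Units.ext (smul_left_injective K hz h)
  refine ⟨?_, fun i => ?_⟩
  · have h : ∀ a : Kˣ, a ^ (χ.2 - 1) = 1 := fun a => by
      have := hy (cocharEval (0, 1) a)
      rw [torusElt_scalarCochar, AlgHom.commutes, charEval_cocharEval] at this
      have := inj hy0 (a := a ^ (1 : ℤ)) this
      rw [zpow_sub, this, mul_inv_eq_one]
      simp
    have := eq_zero_of_forall_zpow_eq_one h
    omega
  -- The `i`-th torus acts as `1 + (a-1)R` with `R` idempotent, so its only possible characters are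
  -- `1` and `a`, according to whether `R` kills the vector.
  · set R := spinRep g K ((1 / 2 : K) • (bvec g K (Sum.inl (Sum.inl i)) *
      bvec g K (Sum.inl (Sum.inr i)))) with hR
    have hRR : R * R = R := by
      rw [hR, ← map_mul, smul_mul_smul_comm, bvec_idem, smul_smul, mul_assoc,
        one_div_mul_cancel h2', mul_one]
    have hact : ∀ a : Kˣ, y + ((a : K) - 1) • R y = ((a ^ χ.1 i : Kˣ) : K) • y := fun a => by
      have h := hy (cocharEval (idemCochar (Sum.inl i)) a)
      have e : (1 : Cl g K) + (((a : K) - 1) / 2) • (bvec g K (Sum.inl (Sum.inl i)) *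
          bvec g K (dualIdx (Sum.inl (Sum.inl i)))) =
          1 + ((a : K) - 1) • ((1 / 2 : K) • (bvec g K (Sum.inl (Sum.inl i)) *
          bvec g K (Sum.inl (Sum.inr i)))) := by
        rw [smul_smul, mul_one_div]; rfl
      rw [torusElt_idemCochar h2', e, map_add, map_one, map_smul, ← hR, charEval_cocharEval] at h
      have e2 : ∑ j, χ.1 j * (idemCochar (Sum.inl i)).1 j + χ.2 * (idemCochar (Sum.inl i)).2 =
          χ.1 i := by simp [idemCochar, Pi.single_apply]
      rw [e2] at h
      exact h
    by_cases hRy : R y = 0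
    · left
      refine eq_zero_of_forall_zpow_eq_one (K := K) fun a => ?_
      have h := hact a
      rw [hRy, smul_zero, add_zero] at h
      refine (inj hy0 (a := 1) ?_).symm
      rw [← h, Units.val_one, one_smul]
    · right
      have h : ∀ a : Kˣ, a ^ (χ.1 i - 1) = 1 := fun a => by
        have h := congrArg R (hact a)
        have hRRy : R (R y) = R y := by rw [← Module.End.mul_apply, hRR]
        rw [map_add, map_smul, map_smul, hRRy] at h
        have : a = a ^ χ.1 i := inj hRy (by rw [← h]; module)
        rw [zpow_sub, ← this, zpow_one, mul_inv_cancel]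
      have := eq_zero_of_forall_zpow_eq_one h
      omega

theorem exists_int_pair (χ : X g) {β : X g} (hβ : β ∈ roots g) : ∃ m : ℤ, pair χ β = m :=
  ⟨_, pair_eq_coroot χ hβ⟩

/-- Characters with the coordinates of a weight of the spin representation are minuscule. -/
theorem exists_pair_eq_of_coords {χ β : X g} (hβ : β ∈ roots g) (h1 : χ.2 = 1)
    (h : ∀ i, χ.1 i = 0 ∨ χ.1 i = 1) : ∃ m : ℤ, pair χ β = m ∧ -1 ≤ m ∧ m ≤ 1 := by
  refine ⟨_, pair_eq_coroot χ hβ, ?_⟩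
  -- A coroot is a sum of two cocharacters `idemCochar` minus the scalar one. Each of the two pairs
  -- with `χ` to `0` or `1`, and the scalar one to `1`.
  have hd : ∀ j : Fin g ⊕ Fin g, ∑ i, χ.1 i * (idemCochar j).1 i + χ.2 * (idemCochar j).2 = 0 ∨
      ∑ i, χ.1 i * (idemCochar j).1 i + χ.2 * (idemCochar j).2 = 1 := by
    rintro (j | j) <;> simp [idemCochar, Pi.single_apply] <;> have := h j <;> omega
  rcases root_cases hβ with ⟨j, k, hjk, h0, rfl⟩ | ⟨j, rfl⟩
  · rw [coroot_long j k hjk h0]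
    have := hd j
    have := hd k
    simp only [Prod.fst_add, Pi.add_apply, Prod.snd_add, Pi.zero_apply, mul_add,
      Finset.sum_add_distrib, mul_zero, Finset.sum_const_zero]
    omega
  · rw [coroot_short j]
    have := hd j
    simp only [Prod.fst_add, Pi.add_apply, Prod.snd_add, Pi.zero_apply, mul_add,
      Finset.sum_add_distrib, mul_zero, Finset.sum_const_zero]
    omega

theorem pair_add (χ η β : X g) : pair (χ + η) β = pair χ β + pair η β := by
  simp only [pair, ← add_div, ← mul_add, ← Finset.sum_add_distrib]
  congr 2
  refine Finset.sum_congr rfl fun i _ => ?_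
  simp only [Prod.fst_add, Pi.add_apply, Prod.snd_add]
  push_cast
  ring

theorem pair_nsmul_nu (a : ℕ) (β : X g) : pair (a • nu g) β = 0 := by
  simp [pair, nu]

theorem pair_sub (χ η β : X g) : pair (χ - η) β = pair χ β - pair η β := by
  rw [eq_sub_iff_add_eq, ← pair_add, sub_add_cancel]

theorem sum_sq_ne_zero {β : X g} (hβ : β ∈ roots g) : ∑ i, (β.1 i : ℚ) ^ 2 ≠ 0 := by
  rcases root_cases hβ with ⟨j, k, hjk, h0, rfl⟩ | ⟨j, rfl⟩
  · have := sum_root_sq j k hjk h0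
    rw [show ∑ i, ((wt (Sum.inl j) + wt (Sum.inl k) : X g).1 i : ℚ) ^ 2 = 2 by exact_mod_cast this]
    exact two_ne_zero
  · have := sum_wt_sq (g := g) j
    rw [show ∑ i, ((wt (Sum.inl j) : X g).1 i : ℚ) ^ 2 = 1 by exact_mod_cast this]
    exact one_ne_zero

theorem pair_self {β : X g} (hβ : β ∈ roots g) : pair β β = 2 := by
  have h2 : β.2 = 0 := by
    rcases root_cases hβ with ⟨j | j, k | k, _, _, rfl⟩ | ⟨j | j, rfl⟩ <;> rfl
  rw [pair, div_eq_iff (sum_sq_ne_zero hβ), h2]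
  simp [sq]

theorem sum_mul_eq_zero_of_pair_eq_zero {χ β : X g} (hβ : β ∈ roots g) (h : pair χ β = 0) :
    ∑ i, (2 * χ.1 i - χ.2) * β.1 i = 0 := by
  rw [pair, div_eq_zero_iff, or_iff_left (sum_sq_ne_zero hβ), Finset.mul_sum] at h
  have : ∑ i, (2 * (χ.1 i : ℚ) - (χ.2 : ℚ)) * (β.1 i : ℚ) = 0 := by
    rw [← h]
    refine Finset.sum_congr rfl fun i _ => ?_
    ring
  exact_mod_cast this

theorem snd_eq_zero_of_mem_roots {β : X g} (hβ : β ∈ roots g) : β.2 = 0 := by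
  rcases root_cases hβ with ⟨j | j, k | k, _, _, rfl⟩ | ⟨j | j, rfl⟩ <;> rfl

/-- A vector which is orthogonal to a root system of rank `g` vanishes. -/
theorem IsSubsystem.eq_zero_of_orthogonal {Φ : Set (X g)} (hΦ : IsSubsystem Φ) (y : Fin g → ℤ)
    (hy : ∀ β ∈ Φ, ∑ i, y i * β.1 i = 0) : y = 0 := by
  by_contra hy0
  -- The kernel of `f` contains the span of `Φ`, of rank `g` inside a lattice of rank `g + 1`, so
  -- the image has rank at most one. For `y ≠ 0` the image contains `(y·y, 0)` and `(0, 1)`, which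
  -- are independent.
  let f : X g →ₗ[ℤ] ℤ × ℤ := LinearMap.prod
    ((∑ i, y i • LinearMap.proj (R := ℤ) (φ := fun _ : Fin g => ℤ) i).comp
      (LinearMap.fst ℤ (Fin g → ℤ) ℤ)) (LinearMap.snd ℤ (Fin g → ℤ) ℤ)
  have hf : ∀ χ : X g, f χ = (∑ i, y i * χ.1 i, χ.2) := fun χ => by
    simp [f, LinearMap.sum_apply]
  have hle : Submodule.span ℤ Φ ≤ LinearMap.ker f := by
    refine Submodule.span_le.2 fun β hβ => ?_
    rw [SetLike.mem_coe, LinearMap.mem_ker, hf, hy β hβ, snd_eq_zero_of_mem_roots (hΦ.subset hβ)]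
    rfl
  have h1 : g ≤ Module.finrank ℤ (LinearMap.ker f) := hΦ.rank.symm.le.trans (Submodule.finrank_mono hle)
  have h2 := Submodule.finrank_quotient_add_finrank (LinearMap.ker f)
  rw [f.quotKerEquivRange.finrank_eq] at h2
  have h3 : Module.finrank ℤ (X g) = g + 1 := by simp
  set N := ∑ i, y i * y i with hN
  have hN0 : N ≠ 0 := by
    intro h
    rw [hN, Finset.sum_eq_zero_iff_of_nonneg (fun i _ => mul_self_nonneg _)] at h
    exact hy0 (funext fun i => mul_self_eq_zero.1 (h i (Finset.mem_univ i)))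
  have h4 : 2 ≤ Module.finrank ℤ (LinearMap.range f) := by
    have hli : LinearIndependent ℤ ![(⟨f (y, 0), LinearMap.mem_range_self f _⟩ : LinearMap.range f),
        ⟨f (0, 1), LinearMap.mem_range_self f _⟩] := by
      rw [LinearIndependent.pair_iff]
      intro s t hst
      have h := congrArg Subtype.val hst
      simp only [Submodule.coe_add, Submodule.coe_smul, Submodule.coe_zero, hf] at h
      have ha := congrArg Prod.fst h
      have hb := congrArg Prod.snd h
      simp at ha hb
      exact ⟨ha.resolve_right hN0, hb⟩
    have := hli.fintype_card_le_finrank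
    simpa using this
  omega

/-- This equation separates `X'` from the line of `ν`, whose last two coordinates are `1` and `2`.
-/
theorem snd_eq_last_of_mem_closure (hg : 1 ≤ g) {v : X g}
    (hv : v ∈ AddSubgroup.closure (Set.range (fundWeight g))) :
    v.2 = v.1 ⟨g - 1, by omega⟩ := by
  induction hv using AddSubgroup.closure_induction with
  | mem x hx =>
    obtain ⟨i, rfl⟩ := hx
    unfold fundWeight
    split_ifs with h
    · rfl
    · have : ¬ ((⟨g - 1, by omega⟩ : Fin g) ≤ i) := by
        rw [Fin.le_def]; have := i.2; simp only; omega
      simp [this]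
  | zero => rfl
  | add x y _ _ hx hy => simp [hx, hy]
  | neg x _ hx => simp [hx]

end SpinWeights

/-! ### Restriction to rational points, and the case `p > 5` -/

section Restriction

variable {g : ℕ} {k : Type*} [Field k] [Finite k]

theorem exists_units_orderOf (k : Type*) [Field k] [Finite k] :
    ∃ a : kˣ, orderOf a = Nat.card k - 1 := by
  obtain ⟨a, ha⟩ := IsCyclic.exists_generator (α := kˣ)
  exact ⟨a, by rw [orderOf_eq_card_of_forall_mem_zpowers ha, Nat.card_units]⟩

/-- Evaluate the coroot at a generator of `k^×`. The point is admissible because `ν` takes the value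
`1` there, which is a `w`-th power. -/
theorem SameRestriction.dvd_of_pair {w : ℕ} {χ η β : X g} (h : SameRestriction k w χ η)
    (hβ : β ∈ roots g) {m m' : ℤ} (hm : pair χ β = m) (hm' : pair η β = m') :
    ((Nat.card k : ℤ) - 1) ∣ m - m' := by
  obtain ⟨a, ha⟩ := exists_units_orderOf k
  have hν : charEval (nu g) (cocharEval (coroot β) a) = a ^ (0 : ℤ) :=
    charEval_coroot _ hβ (by simpa using pair_nsmul_nu 1 β) a
  have h1 := h (cocharEval (coroot β) a) ⟨1, by rw [hν, zpow_zero, one_pow]⟩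
  rw [charEval_coroot χ hβ hm, charEval_coroot η hβ hm'] at h1
  have h2 : a ^ (m - m') = 1 := by rw [zpow_sub, h1, mul_inv_cancel]
  rw [← orderOf_dvd_iff_zpow_eq_one, ha, Nat.cast_sub Nat.card_pos] at h2
  exact_mod_cast h2

theorem SameRestriction.nsmul_nu_eq_zero (hg : 1 ≤ g) {w a : ℕ} {χ : X g}
    (h : SameRestriction k w (χ + a • nu g) χ)
    (ha : a < (Nat.card k - 1) / Nat.gcd w (Nat.card k - 1)) : a = 0 := by
  obtain ⟨b, hb⟩ := exists_units_orderOf k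
  -- This point has multiplier `b^w` with `b` a generator, so triviality of `aν` means `q-1 ∣ wa`,
  -- that is `e ∣ a`.
  have hν : charEval (nu g) (torusPtSingle ⟨0, hg⟩ (b ^ w) 1) = b ^ w := by
    simp [charEval_torusPtSingle, nu]
  have h1 := h (torusPtSingle ⟨0, hg⟩ (b ^ w) 1) ⟨b, hν⟩
  rw [charEval_add, mul_eq_left, charEval_nsmul, hν, ← pow_mul, ← orderOf_dvd_iff_pow_eq_one,
    hb] at h1
  have hpos : 0 < Nat.card k - 1 := by
    have := Finite.one_lt_card (α := k); omega
  have hd := Nat.gcd_pos_of_pos_right w hpos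
  have h2 : (Nat.card k - 1) / Nat.gcd w (Nat.card k - 1) ∣ a := by
    refine (Nat.coprime_div_gcd_div_gcd hd).symm.dvd_of_dvd_mul_left ?_
    refine Nat.dvd_of_mul_dvd_mul_right hd ?_
    rw [Nat.div_mul_cancel (Nat.gcd_dvd_right _ _), mul_right_comm,
      Nat.div_mul_cancel (Nat.gcd_dvd_left _ _)]
    exact h1
  exact Nat.eq_zero_of_dvd_of_lt h2 ha

theorem eq_minuscule_of_isReduced (hg : 1 ≤ g) {p : ℕ} (hp : p.Prime) (hp5 : 5 < p) [CharP k p]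
    {w : ℕ} {Φ Δ : Set (X g)} (hΦ : IsSubsystem Φ) (hΔ : IsBase Φ Δ) {μ : X g}
    (hμ : IsReduced (Nat.card k) w Δ μ) {n : ℕ} (W : RatRep g k Φ n)
    (hW : W.HasHighestWeight Δ μ) (hres : SameRestriction k w μ (minuscule g))
    (hwt : WeightsInSpin w W) : μ = minuscule g := by
  obtain ⟨v, a, hv, ha, rfl, hvΔ⟩ := hμ
  obtain ⟨x, hx0, hx, hfix⟩ := hW
  have hcast : ∀ j : ℕ, 0 < j → j ≤ 5 → (j : k) ≠ 0 := fun j h0 h5 h => by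
    rw [CharP.cast_eq_zero_iff k p] at h
    have := Nat.le_of_dvd h0 h
    omega
  have h2 : (2 : k) ≠ 0 := by exact_mod_cast hcast 2 (by norm_num) (by norm_num)
  have hq0 : (Nat.card k : k) = 0 := by
    have := Fintype.ofFinite k
    rw [Nat.card_eq_fintype_card]
    exact Nat.cast_card_eq_zero k
  have hq : 7 ≤ Nat.card k := by
    have h1 := (CharP.cast_eq_zero_iff k p _).1 hq0
    have := Nat.le_of_dvd Nat.card_pos h1
    have : p ≠ 6 := by rintro rfl; revert hp; norm_num
    omega
  have hpair : ∀ β, pair (v + a • nu g) β = pair v β := fun β => by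
    rw [pair_add, pair_nsmul_nu, add_zero]
  have key : ∀ β ∈ Δ, pair (v - minuscule g) β = 0 := by
    intro β hβ
    have hβΦ := hΔ.subset hβ
    have hβr := hΦ.subset hβΦ
    obtain ⟨m, hm⟩ := exists_int_pair v hβr
    obtain ⟨m₀, hm₀, hm₀1, hm₀2⟩ := exists_pair_eq_of_coords hβr (χ := minuscule g) rfl
      (fun _ => Or.inr rfl)
    obtain ⟨hl, hu⟩ := hvΔ β hβ
    rw [hm] at hl hu
    have hl' : 0 ≤ m := by exact_mod_cast hl
    have hu' : m ≤ (Nat.card k : ℤ) - 1 := by exact_mod_cast hu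
    have hd := hres.dvd_of_pair hβr ((hpair β).trans hm) hm₀
    rw [pair_sub, hm, hm₀, sub_eq_zero, Int.cast_inj]
    by_contra hne
    -- `m - m₀` is a nonzero multiple of `q-1` in `[-1, q]`, so it is `q-1` itself; together with `m
    -- ≤ q-1` this forces `m₀ ≤ 0`.
    have hm_eq : m = (Nat.card k : ℤ) - 1 + m₀ := by
      obtain ⟨c, hc⟩ := hd
      have hc1 : c = 1 := by
        have : 0 < c := by
          by_contra hc0
          rcases eq_or_lt_of_le (not_lt.1 hc0) with h | h
          · rw [h, mul_zero] at hc; omega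
          · nlinarith
        have : c < 2 := by
          by_contra hc2
          nlinarith
        omega
      rw [hc1] at hc; omega
    have hmk : ((m.toNat : ℕ) : k) ≠ 0 := by
      -- As `q = 0` in `k`, the image of `m` is `-(1 - m₀)`, which is `-1` or `-2`.
      have e : m.toNat = Nat.card k - (1 - m₀).toNat := by omega
      rw [e, Nat.cast_sub (by omega), hq0, zero_sub, neg_ne_zero]
      exact hcast _ (by omega) (by omega)
    have hmem := W.sub_mem_weights h2 hβΦ (hΦ.neg_mem β hβΦ) hβr hx0 hx
      (hfix β hβΦ (AddSubmonoid.subset_closure hβ)) (m := m.toNat)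
      (by rw [hpair, hm]; exact_mod_cast (Int.toNat_of_nonneg hl').symm) hmk
    obtain ⟨η, hη, hsame⟩ := hwt _ hmem
    obtain ⟨h1, h01⟩ := coords_of_mem_spinWeights h2 hη
    obtain ⟨m', hm', hm'1, hm'2⟩ := exists_pair_eq_of_coords hβr h1 h01
    have hd' := hsame.dvd_of_pair hβr (m := m - 2)
      (by rw [pair_sub, hpair, hm, pair_self hβr]; push_cast; rfl) hm'
    have hd'' : ((Nat.card k : ℤ) - 1) ∣ m' + 2 - m₀ := by
      have := dvd_sub (dvd_refl ((Nat.card k : ℤ) - 1)) hd'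
      have e : (Nat.card k : ℤ) - 1 - (m - 2 - m') = m' + 2 - m₀ := by omega
      rwa [e] at this
    -- Here `1 ≤ m' + 2 - m₀ ≤ 4`, while `q - 1 ≥ 6`. The value `4` is what `q = 5` would allow.
    have := Int.le_of_dvd (by omega) hd''
    omega
  have hortho : ∀ β ∈ Φ, ∑ i, (2 * (v - minuscule g).1 i - (v - minuscule g).2) * β.1 i = 0 := by
    have hcl : ∀ β ∈ AddSubmonoid.closure Δ,
        ∑ i, (2 * (v - minuscule g).1 i - (v - minuscule g).2) * β.1 i = 0 := by
      intro β hβ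
      induction hβ using AddSubmonoid.closure_induction with
      | mem β hβ => exact sum_mul_eq_zero_of_pair_eq_zero (hΦ.subset (hΔ.subset hβ)) (key β hβ)
      | zero => simp
      | add β γ _ _ h h' =>
        simp only [Prod.fst_add, Pi.add_apply, mul_add, Finset.sum_add_distrib, h, h', add_zero]
    intro β hβ
    rcases hΔ.pos_or_neg β hβ with h | h
    · exact hcl β h
    · have := hcl _ h
      simpa only [Prod.fst_neg, Pi.neg_apply, mul_neg, Finset.sum_neg_distrib, neg_eq_zero] using this
  -- Now `2(v - ϖ̂)_i` equals the last coordinate of `v - ϖ̂` for every `i`. In `X'` that coordinate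
  -- equals the `g`-th one, so both vanish.
  have hy := hΦ.eq_zero_of_orthogonal _ hortho
  have hlast := snd_eq_last_of_mem_closure hg hv
  have hvm : v = minuscule g := by
    have hy' : ∀ i, 2 * (v.1 i - 1) - (v.2 - 1) = 0 := fun i => congrFun hy i
    have h1 := hy' ⟨g - 1, by omega⟩
    rw [← hlast] at h1
    ext i
    · have := hy' i
      simp only [minuscule]
      omega
    · simp only [minuscule]; omega
  subst hvm
  rw [hres.nsmul_nu_eq_zero hg ha, zero_smul, add_zero]

end Restriction
end SpinLemma

namespace SpinLemma
open CliffordAlgebra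

/-! ### The even half of the spin representation for `g = 2` -/

section SpinMatrix

/-- The action of a vector on the spin representation for `g = 2`, in the basis
`e_1 e_2, 1, e_1, e_2`. -/
def spinVecMatrix (R : Type*) [CommRing R] :
    (Idx 2 → R) →ₗ[R] Matrix (Fin 2 ⊕ Fin 2) (Fin 2 ⊕ Fin 2) R where
  toFun x := Matrix.fromBlocks (x (.inr ()) • 1)
    !![-x (.inl (.inl 1)), x (.inl (.inl 0)); 2 * x (.inl (.inr 0)), 2 * x (.inl (.inr 1))]
    !![-2 * x (.inl (.inr 1)), x (.inl (.inl 0)); 2 * x (.inl (.inr 0)), x (.inl (.inl 1))]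
    (-x (.inr ()) • 1)
  map_add' x y := by
    rw [Matrix.fromBlocks_add]
    congr 1
    · simp [add_smul]
    · ext i j; fin_cases i <;> fin_cases j <;> simp <;> ring
    · ext i j; fin_cases i <;> fin_cases j <;> simp <;> ring
    · simp [add_smul]; abel
  map_smul' c x := by
    rw [RingHom.id_apply, Matrix.fromBlocks_smul]
    congr 1
    · simp [mul_smul]
    · ext i j; fin_cases i <;> fin_cases j <;> simp <;> ring
    · ext i j; fin_cases i <;> fin_cases j <;> simp <;> ring
    · simp [mul_smul]

theorem spinVecMatrix_apply {R : Type*} [CommRing R] (x : Idx 2 → R) :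
    spinVecMatrix R x = Matrix.fromBlocks (x (.inr ()) • 1)
    !![-x (.inl (.inl 1)), x (.inl (.inl 0)); 2 * x (.inl (.inr 0)), 2 * x (.inl (.inr 1))]
    !![-2 * x (.inl (.inr 1)), x (.inl (.inl 0)); 2 * x (.inl (.inr 0)), x (.inl (.inl 1))]
    (-x (.inr ()) • 1) := rfl

theorem spinVecMatrix_sq {K : Type*} [Field K] (x : Idx 2 → K) :
    spinVecMatrix K x * spinVecMatrix K x = algebraMap K _ (quadForm 2 K x) := by
  rw [spinVecMatrix_apply, Matrix.fromBlocks_multiply, quadForm_apply, Fin.sum_univ_two]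
  ext i j
  rcases i with i | i <;> rcases j with j | j <;> fin_cases i <;> fin_cases j <;>
    simp [Matrix.algebraMap_matrix_apply, Matrix.mul_apply, Fin.sum_univ_two] <;> ring

/-- The spin representation for `g = 2`, by matrices. -/
def spinMatrix (K : Type*) [Field K] :
    Cl 2 K →ₐ[K] Matrix (Fin 2 ⊕ Fin 2) (Fin 2 ⊕ Fin 2) K :=
  CliffordAlgebra.lift (quadForm 2 K) ⟨spinVecMatrix K, spinVecMatrix_sq⟩

variable {K : Type*} [Field K]

theorem spinMatrix_bvec (j : Idx 2) :
    spinMatrix K (bvec 2 K j) = spinVecMatrix K (Pi.single j 1) := by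
  rw [spinMatrix, bvec, lift_ι_apply]

theorem spinVecMatrix_map {k : Type*} [Field k] [Algebra k K] (x : Idx 2 → k) :
    spinVecMatrix K (fun j => algebraMap k K (x j)) = (spinVecMatrix k x).map (algebraMap k K) := by
  rw [spinVecMatrix_apply, spinVecMatrix_apply, Matrix.fromBlocks_map]
  have h2 : algebraMap k K 2 = 2 := map_ofNat _ 2
  congr 1 <;> ext i j <;> fin_cases i <;> fin_cases j <;> simp [h2]

/-- The action of an element of the Clifford algebra on the even half of the spin representation,
for elements that preserve the two halves. -/
def evenBlock : Cl 2 K →ₗ[K] Matrix (Fin 2) (Fin 2) K where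
  toFun x := (spinMatrix K x).toBlocks₁₁
  map_add' x y := by rw [map_add]; rfl
  map_smul' c x := by rw [map_smul]; rfl

theorem evenBlock_one : evenBlock (1 : Cl 2 K) = 1 := by
  change (spinMatrix K 1).toBlocks₁₁ = 1
  rw [map_one, ← Matrix.fromBlocks_one, Matrix.toBlocks_fromBlocks₁₁]

/-- `e_0` acts as `1` on the even half and `-1` on the odd half, so commuting with it means
preserving both halves. -/
theorem toBlocks₁₂_eq_zero_of_commute (h2 : (2 : K) ≠ 0) {x : Cl 2 K}
    (hx : Commute x (bvec 2 K (.inr ()))) : (spinMatrix K x).toBlocks₁₂ = 0 := by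
  have h : spinMatrix K x * spinMatrix K (bvec 2 K (.inr ())) =
      spinMatrix K (bvec 2 K (.inr ())) * spinMatrix K x := by
    rw [← map_mul, ← map_mul, hx.eq]
  rw [spinMatrix_bvec] at h
  have hJ : spinVecMatrix K (Pi.single (.inr ()) 1) = Matrix.fromBlocks 1 0 0 (-1) := by
    rw [spinVecMatrix_apply]
    congr 1 <;> ext i j <;> fin_cases i <;> fin_cases j <;> simp
  rw [hJ] at h
  nth_rw 1 [← Matrix.fromBlocks_toBlocks (spinMatrix K x)] at h
  nth_rw 5 [← Matrix.fromBlocks_toBlocks (spinMatrix K x)] at h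
  rw [Matrix.fromBlocks_multiply, Matrix.fromBlocks_multiply, Matrix.fromBlocks_inj] at h
  have h12 := h.2.1
  simp only [mul_zero, Matrix.mul_neg, mul_one, zero_add, one_mul, zero_mul, add_zero] at h12
  have h3 : (2 : K) • (spinMatrix K x).toBlocks₁₂ = 0 := by
    rw [two_smul]; nth_rw 1 [← h12]; rw [neg_add_cancel]
  exact (smul_eq_zero.1 h3).resolve_left h2

theorem evenBlock_mul (h2 : (2 : K) ≠ 0) {x : Cl 2 K}
    (hx : Commute x (bvec 2 K (.inr ()))) (y : Cl 2 K) :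
    evenBlock (x * y) = evenBlock x * evenBlock y := by
  change (spinMatrix K (x * y)).toBlocks₁₁ = _
  rw [map_mul, ← Matrix.fromBlocks_toBlocks (spinMatrix K x),
    ← Matrix.fromBlocks_toBlocks (spinMatrix K y), Matrix.fromBlocks_multiply,
    Matrix.toBlocks_fromBlocks₁₁, toBlocks₁₂_eq_zero_of_commute h2 hx, zero_mul, add_zero]
  rfl

theorem evenBlock_bvec_mul_bvec (j k : Fin 2 ⊕ Fin 2) :
    evenBlock (bvec 2 K (.inl j) * bvec 2 K (.inl k)) =
      (spinVecMatrix K (Pi.single (.inl j) 1)).toBlocks₁₂ *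
      (spinVecMatrix K (Pi.single (.inl k) 1)).toBlocks₂₁ := by
  change (spinMatrix K (_ * _)).toBlocks₁₁ = _
  rw [map_mul, spinMatrix_bvec, spinMatrix_bvec, spinVecMatrix_apply, spinVecMatrix_apply,
    Matrix.fromBlocks_multiply, Matrix.toBlocks_fromBlocks₁₁, Matrix.toBlocks_fromBlocks₁₂,
    Matrix.toBlocks_fromBlocks₂₁]
  simp

theorem commute_bvec_mul_bvec (j k : Fin 2 ⊕ Fin 2) :
    Commute (bvec 2 K (.inl j) * bvec 2 K (.inl k)) (bvec 2 K (.inr ())) := by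
  have h : ∀ j : Fin 2 ⊕ Fin 2, bvec 2 K (.inr ()) * bvec 2 K (.inl j) =
      -(bvec 2 K (.inl j) * bvec 2 K (.inr ())) := fun j =>
    bvec_mul_bvec_swap _ _ (by rcases j with j | j <;> simp [dualIdx])
  rw [Commute, SemiconjBy, ← mul_assoc, h, neg_mul, mul_assoc, mul_assoc, h, mul_neg, neg_neg]

theorem commute_torusElt (h2 : (2 : K) ≠ 0) (t : TorusPt 2 K) :
    Commute (torusElt t : Cl 2 K) (bvec 2 K (.inr ())) := by
  have h := torusElt_mul_bvec h2 t (.inr ())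
  rw [show wt (.inr ()) = (0 : X 2) from rfl, charEval_zero, Units.val_one, one_smul] at h
  exact h

theorem idx_of_wt_add_wt_mem_longRoots {j k : Idx 2} (h : wt j + wt k ∈ longRoots) :
    ∃ j' k', j = .inl j' ∧ k = .inl k' := by
  have hs : ∀ α ∈ longRoots, ∑ i, α.1 i ^ 2 = 2 := by
    rintro α (rfl | rfl | rfl | rfl) <;> simp [Fin.sum_univ_two]
  rcases j with j | j <;> rcases k with k | k
  · exact ⟨j, k, rfl, rfl⟩
  · have := hs _ h
    rw [show wt (.inr k) = (0 : X 2) from rfl, add_zero, sum_wt_sq] at this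
    norm_num at this
  · have := hs _ h
    rw [show wt (.inr j) = (0 : X 2) from rfl, zero_add, sum_wt_sq] at this
    norm_num at this
  · have := hs _ h
    simp [wt] at this

/-- A long root vector is a product of two isotropic basis vectors. Each anticommutes with `e_0`, so
the product commutes with it. -/
theorem commute_of_mem_H0 (h2 : (2 : K) ≠ 0) {u : (Cl 2 K)ˣ} (hu : u ∈ H0 2 K longRoots) :
    Commute (u : Cl 2 K) (bvec 2 K (.inr ())) := by
  induction hu using Subgroup.closure_induction with
  | mem u hu =>
    rcases hu with ⟨t, rfl⟩ | ⟨α, hα, j, k, s, _, hjk, hu⟩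
    · exact commute_torusElt h2 t
    · obtain ⟨j, k, rfl, rfl⟩ := idx_of_wt_add_wt_mem_longRoots (hjk ▸ hα)
      rw [hu]
      exact (Commute.one_left _).add_left ((commute_bvec_mul_bvec j k).smul_left s)
  | one => exact Commute.one_left _
  | mul u v _ _ hu hv => exact hu.mul_left hv
  | inv u _ hu => exact hu.units_inv_left

/-- The representation of `H⁰` on the even half of the spin representation. -/
def evenHom (h2 : (2 : K) ≠ 0) : H0 2 K longRoots →* Matrix (Fin 2) (Fin 2) K where
  toFun h := evenBlock ((h : (Cl 2 K)ˣ) : Cl 2 K)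
  map_one' := evenBlock_one
  map_mul' h h' := evenBlock_mul h2 (commute_of_mem_H0 h2 h.2) _

theorem evenBlock_torusElt (h2 : (2 : K) ≠ 0) (t : TorusPt 2 K) :
    evenBlock (torusElt t : Cl 2 K) =
      Matrix.diagonal ![(charEval (minuscule 2) t : K), (charEval ((0, 1) : X 2) t : K)] := by
  have hf : ∀ i a, evenBlock (torusFactor 2 K i a : Cl 2 K) = Matrix.diagonal ![(a : K), 1] := by
    intro i a
    rw [torusFactor, map_add, map_smul, evenBlock_one, evenBlock_bvec_mul_bvec,
      spinVecMatrix_apply, spinVecMatrix_apply, Matrix.toBlocks_fromBlocks₁₂,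
      Matrix.toBlocks_fromBlocks₂₁]
    ext r s
    fin_cases i <;> fin_cases r <;> fin_cases s <;>
      simp [Matrix.mul_apply, Fin.sum_univ_two, h2]
  have hc : ∀ i a, Commute (torusFactor 2 K i a : Cl 2 K) (bvec 2 K (.inr ())) := fun i a => by
    have := torusFactor_mul_bvec h2 i a (.inr ())
    simpa [wt, Commute, SemiconjBy] using this
  have e : (torusElt t : Cl 2 K) = (t.2 : K) •
      ((torusFactor 2 K 0 (t.1 0) : Cl 2 K) * (torusFactor 2 K 1 (t.1 1) : Cl 2 K)) := by
    rw [Algebra.smul_def, torusElt, Units.val_mul]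
    simp [List.ofFn_succ]
  rw [e, map_smul, evenBlock_mul h2 (hc _ _), hf, hf]
  ext r s
  fin_cases r <;> fin_cases s <;>
    simp [charEval, minuscule, Fin.prod_univ_two, mul_comm]

theorem exists_evenBlock_eq_upper {u : (Cl 2 K)ˣ} (hu : IsRootElt (g := 2) (![1, 1], 0) u) :
    ∃ s, evenBlock (u : Cl 2 K) = !![1, s; 0, 1] := by
  obtain ⟨j, k, s, _, hjk, hu⟩ := hu
  have key : ∀ j k : Fin 2 ⊕ Fin 2, (wt (.inl j) + wt (.inl k) : X 2) = (![1, 1], 0) →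
      (j = .inl 0 ∧ k = .inl 1) ∨ (j = .inl 1 ∧ k = .inl 0) := by
    rintro (j | j) (k | k) h <;> fin_cases j <;> fin_cases k <;> revert h <;> decide
  obtain ⟨j, k, rfl, rfl⟩ := idx_of_wt_add_wt_mem_longRoots
    (show _ ∈ longRoots by rw [hjk]; exact Or.inl rfl)
  rw [hu, map_add, map_smul, evenBlock_one]
  rcases key j k hjk with ⟨rfl, rfl⟩ | ⟨rfl, rfl⟩
  · refine ⟨s, ?_⟩
    rw [evenBlock_bvec_mul_bvec, spinVecMatrix_apply, spinVecMatrix_apply]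
    ext r s
    fin_cases r <;> fin_cases s <;> simp [Matrix.mul_apply, Fin.sum_univ_two]
  · refine ⟨-s, ?_⟩
    rw [evenBlock_bvec_mul_bvec, spinVecMatrix_apply, spinVecMatrix_apply]
    ext r s
    fin_cases r <;> fin_cases s <;> simp [Matrix.mul_apply, Fin.sum_univ_two]

theorem exists_evenBlock_eq_lower {u : (Cl 2 K)ˣ} (hu : IsRootElt (g := 2) (![-1, -1], 0) u) :
    ∃ s, evenBlock (u : Cl 2 K) = !![1, 0; s, 1] := by
  obtain ⟨j, k, s, _, hjk, hu⟩ := hu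
  have key : ∀ j k : Fin 2 ⊕ Fin 2, (wt (.inl j) + wt (.inl k) : X 2) = (![-1, -1], 0) →
      (j = .inr 0 ∧ k = .inr 1) ∨ (j = .inr 1 ∧ k = .inr 0) := by
    rintro (j | j) (k | k) h <;> fin_cases j <;> fin_cases k <;> revert h <;> decide
  obtain ⟨j, k, rfl, rfl⟩ := idx_of_wt_add_wt_mem_longRoots
    (show _ ∈ longRoots by rw [hjk]; exact Or.inr (Or.inr (Or.inr rfl)))
  rw [hu, map_add, map_smul, evenBlock_one]
  rcases key j k hjk with ⟨rfl, rfl⟩ | ⟨rfl, rfl⟩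
  · refine ⟨-(s * (2 * 2)), ?_⟩
    rw [evenBlock_bvec_mul_bvec, spinVecMatrix_apply, spinVecMatrix_apply]
    ext r s
    fin_cases r <;> fin_cases s <;> simp [Matrix.mul_apply, Fin.sum_univ_two]
  · refine ⟨s * (2 * 2), ?_⟩
    rw [evenBlock_bvec_mul_bvec, spinVecMatrix_apply, spinVecMatrix_apply]
    ext r s
    fin_cases r <;> fin_cases s <;> simp [Matrix.mul_apply, Fin.sum_univ_two]

/-- The root vector is, up to sign, `e_1 e'_2`. Contraction kills `1` and turns `e_1 e_2` into a
multiple of `e_1`, which `e_1` kills. So this root subgroup acts trivially on the even half. -/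
theorem evenBlock_eq_one {u : (Cl 2 K)ˣ} (hu : IsRootElt (g := 2) (![1, -1], 0) u) :
    evenBlock (u : Cl 2 K) = 1 := by
  obtain ⟨j, k, s, _, hjk, hu⟩ := hu
  have key : ∀ j k : Fin 2 ⊕ Fin 2, (wt (.inl j) + wt (.inl k) : X 2) = (![1, -1], 0) →
      (j = .inl 0 ∧ k = .inr 1) ∨ (j = .inr 1 ∧ k = .inl 0) := by
    rintro (j | j) (k | k) h <;> fin_cases j <;> fin_cases k <;> revert h <;> decide
  obtain ⟨j, k, rfl, rfl⟩ := idx_of_wt_add_wt_mem_longRoots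
    (show _ ∈ longRoots by rw [hjk]; exact Or.inr (Or.inl rfl))
  rw [hu, map_add, map_smul, evenBlock_one]
  rcases key j k hjk with ⟨rfl, rfl⟩ | ⟨rfl, rfl⟩
  · rw [evenBlock_bvec_mul_bvec, spinVecMatrix_apply, spinVecMatrix_apply]
    ext r s
    fin_cases r <;> fin_cases s <;> simp [Matrix.mul_apply, Fin.sum_univ_two]
  · rw [evenBlock_bvec_mul_bvec, spinVecMatrix_apply, spinVecMatrix_apply]
    ext r s
    fin_cases r <;> fin_cases s <;> simp [Matrix.mul_apply, Fin.sum_univ_two]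

theorem exists_mem_H0_upper (s : K) :
    ∃ h : H0 2 K longRoots, evenBlock ((h : (Cl 2 K)ˣ) : Cl 2 K) = !![1, s; 0, 1] := by
  have hsq : (bvec 2 K (.inl (.inl 0)) * bvec 2 K (.inl (.inl 1))) *
      (bvec 2 K (.inl (.inl 0)) * bvec 2 K (.inl (.inl 1))) = 0 := by
    rw [mul_assoc, ← mul_assoc (bvec 2 K (.inl (.inl 1))),
      bvec_mul_bvec_swap (.inl (.inl 0)) (.inl (.inl 1)) (by simp [dualIdx]), neg_mul, mul_neg,
      mul_assoc, bvec_sq_left]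
    simp
  refine ⟨⟨unipotentUnit _ hsq s, Subgroup.subset_closure (Or.inr ⟨(![1, 1], 0), Or.inl rfl, _, _,
    s, by simp, by decide, rfl⟩)⟩, ?_⟩
  simp only [unipotentUnit]
  rw [map_add, map_smul, evenBlock_one, evenBlock_bvec_mul_bvec, spinVecMatrix_apply,
    spinVecMatrix_apply]
  ext r s
  fin_cases r <;> fin_cases s <;> simp [Matrix.mul_apply, Fin.sum_univ_two]

theorem exists_mem_H0_lower (h2 : (2 : K) ≠ 0) (s : K) :
    ∃ h : H0 2 K longRoots, evenBlock ((h : (Cl 2 K)ˣ) : Cl 2 K) = !![1, 0; s, 1] := by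
  have hsq : (bvec 2 K (.inl (.inr 0)) * bvec 2 K (.inl (.inr 1))) *
      (bvec 2 K (.inl (.inr 0)) * bvec 2 K (.inl (.inr 1))) = 0 := by
    rw [mul_assoc, ← mul_assoc (bvec 2 K (.inl (.inr 1))),
      bvec_mul_bvec_swap (.inl (.inr 0)) (.inl (.inr 1)) (by simp [dualIdx]), neg_mul, mul_neg,
      mul_assoc, bvec_sq_right]
    simp
  -- Each `e'_i` acts as twice a contraction, so `e'_1 e'_2` takes `e_1 e_2` to `-4`.
  refine ⟨⟨unipotentUnit _ hsq (-s / (2 * 2)), Subgroup.subset_closure (Or.inr ⟨(![-1, -1], 0),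
    Or.inr (Or.inr (Or.inr rfl)), _, _, _, by simp, by decide, rfl⟩)⟩, ?_⟩
  simp only [unipotentUnit]
  rw [map_add, map_smul, evenBlock_one, evenBlock_bvec_mul_bvec, spinVecMatrix_apply,
    spinVecMatrix_apply]
  ext r s
  fin_cases r <;> fin_cases s <;> simp [Matrix.mul_apply, Fin.sum_univ_two]
  field_simp

/-- The matrices of the basis vectors are defined over `k`, hence so are those of their products.
This is the rationality demanded of generators of `regularFunctions`. -/
theorem evenBlock_list_prod_mem_range {k : Type*} [Field k] [Algebra k K] (l : List (Idx 2))
    (i j : Fin 2) : evenBlock (l.map (bvec 2 K)).prod i j ∈ Set.range (algebraMap k K) := by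
  have h : ∃ M : Matrix (Fin 2 ⊕ Fin 2) (Fin 2 ⊕ Fin 2) k,
      spinMatrix K (l.map (bvec 2 K)).prod = M.map (algebraMap k K) := by
    induction l with
    | nil => exact ⟨1, by simp⟩
    | cons a l ih =>
      obtain ⟨M, hM⟩ := ih
      refine ⟨spinVecMatrix k (Pi.single a 1) * M, ?_⟩
      rw [List.map_cons, List.prod_cons, map_mul, hM, Matrix.map_mul, ← spinVecMatrix_map,
        spinMatrix_bvec]
      congr 2
      funext b
      by_cases hb : b = a
      · subst hb; simp
      · simp [hb]
  obtain ⟨M, hM⟩ := h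
  exact ⟨M (.inl i) (.inl j), by
    change _ = spinMatrix K _ (.inl i) (.inl j)
    rw [hM]; rfl⟩

theorem evenBlock_mem_regularFunctions (k : Type*) [Field k] [Algebra k K] (i j : Fin 2) :
    (fun u : (Cl 2 K)ˣ => evenBlock (u : Cl 2 K) i j) ∈ regularFunctions 2 k K ∧
    (fun u : (Cl 2 K)ˣ => evenBlock ((u⁻¹ : (Cl 2 K)ˣ) : Cl 2 K) i j) ∈
      regularFunctions 2 k K := by
  let φ : Cl 2 K →ₗ[K] K := (Matrix.entryLinearMap K K i j).comp evenBlock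
  exact ⟨Algebra.subset_adjoin ⟨φ, fun l => evenBlock_list_prod_mem_range l i j, Or.inl rfl⟩,
    Algebra.subset_adjoin ⟨φ, fun l => evenBlock_list_prod_mem_range l i j, Or.inr rfl⟩⟩

end SpinMatrix
end SpinLemma

namespace SpinLemma
open CliffordAlgebra

/-! ### The symmetric cube of a two-dimensional representation -/

section SymCube

/-- The third symmetric power of a `2 × 2` matrix, in the basis `x³, x² y, x y², y³`. -/
def symCube (R : Type*) [CommRing R] : Matrix (Fin 2) (Fin 2) R →* Matrix (Fin 4) (Fin 4) R where
  toFun A :=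
    let a := A 0 0
    let b := A 0 1
    let c := A 1 0
    let d := A 1 1
    !![a ^ 3, a ^ 2 * b, a * b ^ 2, b ^ 3;
       3 * a ^ 2 * c, a ^ 2 * d + 2 * a * b * c, 2 * a * b * d + b ^ 2 * c, 3 * b ^ 2 * d;
       3 * a * c ^ 2, 2 * a * c * d + b * c ^ 2, a * d ^ 2 + 2 * b * c * d, 3 * b * d ^ 2;
       c ^ 3, c ^ 2 * d, c * d ^ 2, d ^ 3]
  map_one' := by
    ext i j; fin_cases i <;> fin_cases j <;> simp
  map_mul' A B := by
    ext i j; fin_cases i <;> fin_cases j <;>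
      simp [Matrix.mul_apply, Fin.sum_univ_four, Fin.sum_univ_two] <;> ring

theorem symCube_apply {R : Type*} [CommRing R] (a b c d : R) :
    symCube R !![a, b; c, d] =
    !![a ^ 3, a ^ 2 * b, a * b ^ 2, b ^ 3;
       3 * a ^ 2 * c, a ^ 2 * d + 2 * a * b * c, 2 * a * b * d + b ^ 2 * c, 3 * b ^ 2 * d;
       3 * a * c ^ 2, 2 * a * c * d + b * c ^ 2, a * d ^ 2 + 2 * b * c * d, 3 * b * d ^ 2;
       c ^ 3, c ^ 2 * d, c * d ^ 2, d ^ 3] := rfl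

theorem symCube_map {R S : Type*} [CommRing R] [CommRing S] (f : R →+* S)
    (A : Matrix (Fin 2) (Fin 2) R) : symCube S (A.map f) = (symCube R A).map f := by
  have h2 : f 2 = 2 := map_ofNat f 2
  have h3 : f 3 = 3 := map_ofNat f 3
  ext i j; fin_cases i <;> fin_cases j <;> simp [symCube, h2, h3]

variable {K : Type*} [Field K]

/-- The third symmetric power of the standard representation of `SL₂` is simple unless the
characteristic is `2` or `3`. -/
theorem symCube_simple (h2 : (2 : K) ≠ 0) (h3 : (3 : K) ≠ 0) (M : Submodule K (Fin 4 → K))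
    (hu : ∀ s, ∀ x ∈ M, (symCube K !![1, s; 0, 1]).mulVec x ∈ M)
    (hl : ∀ s, ∀ x ∈ M, (symCube K !![1, 0; s, 1]).mulVec x ∈ M) (hM : M ≠ ⊥) : M = ⊤ := by
  have h12 : (12 : K) ≠ 0 := by
    rw [show (12 : K) = 2 * 2 * 3 by norm_num]
    exact mul_ne_zero (mul_ne_zero h2 h2) h3
  -- The action of `u(s)` is cubic in `s`. The difference `(8(f(1) - f(-1)) - (f(2) - f(-2))) / 12`
  -- cancels the cubic terms and leaves the derivative at `0`, the raising operator.
  have hU : ∀ x ∈ M, ![x 1, 2 * x 2, 3 * x 3, 0] ∈ M := by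
    intro x hx
    have h := M.smul_mem (1 / 12) (M.sub_mem (M.smul_mem 8 (M.sub_mem (hu 1 x hx) (hu (-1) x hx)))
      (M.sub_mem (hu 2 x hx) (hu (-2) x hx)))
    convert h using 1
    ext i
    fin_cases i <;>
      simp [symCube_apply, Matrix.mulVec, dotProduct, Fin.sum_univ_four] <;> field_simp <;> ring
  have hL : ∀ x ∈ M, ![0, 3 * x 0, 2 * x 1, x 2] ∈ M := by
    intro x hx
    have h := M.smul_mem (1 / 12) (M.sub_mem (M.smul_mem 8 (M.sub_mem (hl 1 x hx) (hl (-1) x hx)))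
      (M.sub_mem (hl 2 x hx) (hl (-2) x hx)))
    convert h using 1
    ext i
    fin_cases i <;>
      simp [symCube_apply, Matrix.mulVec, dotProduct, Fin.sum_univ_four] <;> field_simp <;> ring
  have scale : ∀ {y z : Fin 4 → K} {c : K}, c ≠ 0 → y ∈ M → y = c • z → z ∈ M := by
    intro y z c hc hy h
    rw [h] at hy
    exact (M.smul_mem_iff hc).1 hy
  have h6 : (3 * 2 : K) ≠ 0 := mul_ne_zero h3 h2
  obtain ⟨x, hx, hx0⟩ := M.ne_bot_iff.1 hM
  -- Raise until only the top coordinate survives. The lowering operator then produces the whole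
  -- basis from it.
  have e0 : (![1, 0, 0, 0] : Fin 4 → K) ∈ M := by
    by_cases hx3 : x 3 = 0
    · by_cases hx2 : x 2 = 0
      · by_cases hx1 : x 1 = 0
        · have hx00 : x 0 ≠ 0 := fun h => hx0 (by
            ext i; fin_cases i <;> simp [h, hx1, hx2, hx3])
          refine scale hx00 hx ?_
          ext i; fin_cases i <;> simp [hx1, hx2, hx3]
        · refine scale hx1 (hU _ hx) ?_
          ext i; fin_cases i <;> simp [hx2, hx3]
      · refine scale (mul_ne_zero h2 hx2) (hU _ (hU _ hx)) ?_
        ext i; fin_cases i <;> simp [hx3]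
    · refine scale (mul_ne_zero h6 hx3) (hU _ (hU _ (hU _ hx))) ?_
      ext i; fin_cases i <;> simp; ring
  have e1 : (![0, 1, 0, 0] : Fin 4 → K) ∈ M := by
    refine scale h3 (hL _ e0) ?_
    ext i; fin_cases i <;> simp
  have e2 : (![0, 0, 1, 0] : Fin 4 → K) ∈ M := by
    refine scale h2 (hL _ e1) ?_
    ext i; fin_cases i <;> simp
  have e3 : (![0, 0, 0, 1] : Fin 4 → K) ∈ M := by
    refine scale one_ne_zero (hL _ e2) ?_
    ext i; fin_cases i <;> simp
  refine eq_top_iff.2 fun y _ => ?_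
  have h := M.add_mem (M.add_mem (M.smul_mem (y 0) e0) (M.smul_mem (y 1) e1))
    (M.add_mem (M.smul_mem (y 2) e2) (M.smul_mem (y 3) e3))
  convert h using 1
  ext i; fin_cases i <;> simp

end SymCube

/-! ### Descent from the algebraic closure, and separation of characters -/

section Descent

/-- A subspace which becomes everything after extension of scalars is everything. -/
theorem eq_top_of_span_image_eq_top {k K : Type*} [Field k] [Field K] [Algebra k K] {n : ℕ}
    {U : Submodule k (Fin n → k)}
    (h : Submodule.span K ((fun (y : Fin n → k) (i : Fin n) => algebraMap k K (y i)) ''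
      (U : Set (Fin n → k))) = ⊤) : U = ⊤ := by
  by_contra hU
  obtain ⟨f, hf0, hf⟩ := U.exists_le_ker_of_lt_top (lt_top_iff_ne_top.2 hU)
  -- A proper subspace lies in the kernel of a nonzero functional over `k`; its extension to `K`
  -- kills the whole span.
  let F : (Fin n → K) →ₗ[K] K :=
    ∑ i, algebraMap k K (f (Pi.single i 1)) • LinearMap.proj (R := K) (φ := fun _ => K) i
  have hF : ∀ x, F x = ∑ i, algebraMap k K (f (Pi.single i 1)) * x i := fun x => by
    simp [F, LinearMap.sum_apply, Algebra.smul_def]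
  have hle : (⊤ : Submodule K (Fin n → K)) ≤ LinearMap.ker F := by
    rw [← h, Submodule.span_le]
    rintro _ ⟨y, hy, rfl⟩
    rw [SetLike.mem_coe, LinearMap.mem_ker, hF]
    simp only [← map_mul, ← map_sum]
    have h0 : f y = 0 := hf hy
    have hy' : y = ∑ i, y i • (Pi.single i 1 : Fin n → k) := by
      ext j; simp [Finset.sum_apply, Pi.single_apply]
    rw [hy', map_sum] at h0
    simp only [map_smul, smul_eq_mul] at h0
    simp only [mul_comm (f _), h0, map_zero]
  refine hf0 (LinearMap.pi_ext' fun i => LinearMap.ext_ring ?_)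
  have h1 : F (Pi.single i 1) = 0 := hle trivial
  rw [hF] at h1
  simp only [Pi.single_apply, mul_ite, mul_one, mul_zero, Finset.sum_ite_eq', Finset.mem_univ,
    if_true] at h1
  have := (map_eq_zero (algebraMap k K)).1 h1
  simpa using this

theorem eq_of_charEval_eq {g : ℕ} {K : Type*} [Field K] [Infinite K] {χ η : X g}
    (h : ∀ t : TorusPt g K, charEval χ t = charEval η t) : χ = η := by
  have h' : ∀ i (a z : Kˣ), a ^ (χ.1 i - η.1 i) * z ^ (χ.2 - η.2) = 1 := fun i a z => by
    have := h (torusPtSingle i a z)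
    rw [charEval_torusPtSingle, charEval_torusPtSingle] at this
    rw [zpow_sub, zpow_sub, ← div_eq_mul_inv, ← div_eq_mul_inv, div_mul_div_comm, this, div_self']
  ext i
  · have := eq_zero_of_forall_zpow_eq_one (K := K) fun a => by simpa using h' i a 1
    omega
  · have := eq_zero_of_forall_zpow_eq_one (K := K) (m := χ.2 - η.2) fun z => by
      have := h ((1, z) : TorusPt g K)
      simp only [charEval, Pi.one_apply, one_zpow, Finset.prod_const_one, one_mul] at this
      rw [zpow_sub, this, mul_inv_cancel]
    omega

end Descent

/-! ### Symmetric cubes as rational representations -/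

section SymCubeRep

variable {g : ℕ} {k : Type*} [Field k] {Φ : Set (X g)}

local notation "k̄" => AlgebraicClosure k

/-- The entries of `θ` are regular functions defined over `k`. -/
def HasRegularEntries (θ : H0 g k̄ Φ →* Matrix (Fin 2) (Fin 2) k̄) : Prop :=
  ∀ i j, ∃ f ∈ regularFunctions g k k̄, ∀ h : H0 g k̄ Φ, θ h i j = f h

/-- The third symmetric power of a two-dimensional rational representation. -/
noncomputable def symCubeRep (θ : H0 g k̄ Φ →* Matrix (Fin 2) (Fin 2) k̄)
    (hθ : HasRegularEntries (k := k) θ) :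
    RatRep g k Φ 4 where
  toHom := (symCube k̄).comp θ
  regular i j := by
    choose f hf hfθ using hθ
    -- The cube is formed over the ring of regular functions and then evaluated at `h`; naturality
    -- of `symCube` in the ring shows that its entries are regular.
    let A : Matrix (Fin 2) (Fin 2) (regularFunctions g k k̄) := fun i j => ⟨f i j, hf i j⟩
    refine ⟨(symCube _ A i j : regularFunctions g k k̄), Subtype.property _, fun h => ?_⟩
    let ev : regularFunctions g k k̄ →+* k̄ :=
      (Pi.evalRingHom (fun _ : (Cl g k̄)ˣ => k̄) (h : (Cl g k̄)ˣ)).comp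
        (regularFunctions g k k̄).val.toRingHom
    have hA : θ h = A.map ev := by
      ext i j; exact hfθ i j h
    rw [MonoidHom.comp_apply, hA, symCube_map]
    rfl

theorem symCubeRep_toHom (θ : H0 g k̄ Φ →* Matrix (Fin 2) (Fin 2) k̄)
    (hθ : HasRegularEntries (k := k) θ) (h : H0 g k̄ Φ) :
    (symCubeRep (k := k) θ hθ).toHom h = symCube k̄ (θ h) := rfl

/-- The span over `k̄` of a nonzero stable `k`-subspace is stable under both unipotent groups of
`SL₂`, hence everything, and this descends to `k`. -/
theorem symCubeRep_isSimple {θ : H0 g k̄ Φ →* Matrix (Fin 2) (Fin 2) k̄}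
    {hθ : HasRegularEntries (k := k) θ}
    (h2 : (2 : k) ≠ 0) (h3 : (3 : k) ≠ 0)
    (hu : ∀ s : k̄, ∃ h, θ h = !![1, s; 0, 1]) (hl : ∀ s : k̄, ∃ h, θ h = !![1, 0; s, 1]) :
    (symCubeRep (k := k) θ hθ).IsSimple := by
  have h2' : (2 : k̄) ≠ 0 := fun h => h2 ((algebraMap k k̄).injective (by
    rw [map_ofNat, map_zero, h]))
  have h3' : (3 : k̄) ≠ 0 := fun h => h3 ((algebraMap k k̄).injective (by
    rw [map_ofNat, map_zero, h]))
  refine ⟨by norm_num, fun U hU => or_iff_not_imp_left.2 fun hU0 => ?_⟩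
  set M := Submodule.span k̄ ((fun (y : Fin 4 → k) (i : Fin 4) => algebraMap k k̄ (y i)) ''
    (U : Set (Fin 4 → k))) with hM
  have hstab : ∀ h, ∀ x ∈ M, (symCube k̄ (θ h)).mulVec x ∈ M := by
    intro h x hx
    induction hx using Submodule.span_induction with
    | mem x hx =>
      obtain ⟨y, hy, rfl⟩ := hx
      exact hU h y hy
    | zero => rw [Matrix.mulVec_zero]; exact M.zero_mem
    | add x y _ _ hx hy => rw [Matrix.mulVec_add]; exact M.add_mem hx hy
    | smul c x _ hx => rw [Matrix.mulVec_smul]; exact M.smul_mem c hx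
  refine eq_top_of_span_image_eq_top (K := k̄)
    (symCube_simple h2' h3' M (fun s => ?_) (fun s => ?_) ?_)
  · obtain ⟨h, hh⟩ := hu s
    rw [← hh]; exact hstab h
  · obtain ⟨h, hh⟩ := hl s
    rw [← hh]; exact hstab h
  · obtain ⟨x, hx, hx0⟩ := U.ne_bot_iff.1 hU0
    refine M.ne_bot_iff.2 ⟨_, Submodule.subset_span ⟨x, hx, rfl⟩, fun h => hx0 ?_⟩
    ext i
    exact (map_eq_zero (algebraMap k k̄)).1 (congrFun h i)

theorem symCubeRep_torus {θ : H0 g k̄ Φ →* Matrix (Fin 2) (Fin 2) k̄}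
    {hθ : HasRegularEntries (k := k) θ}
    {χ₁ χ₂ : X g}
    (ht : ∀ t : TorusPt g k̄, θ ⟨torusElt t, torusElt_mem Φ t⟩ =
      Matrix.diagonal ![(charEval χ₁ t : k̄), (charEval χ₂ t : k̄)]) (t : TorusPt g k̄) :
    (symCubeRep (k := k) θ hθ).toHom ⟨torusElt t, torusElt_mem Φ t⟩ =
      Matrix.diagonal fun i => ((charEval
        (![(3 : ℤ) • χ₁, (2 : ℤ) • χ₁ + χ₂, χ₁ + (2 : ℤ) • χ₂, (3 : ℤ) • χ₂] i) t : k̄ˣ) : k̄) := by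
  have hz : ∀ (u : k̄ˣ), u ^ (3 : ℤ) = u ^ 3 ∧ u ^ (2 : ℤ) = u ^ 2 := fun u => ⟨rfl, rfl⟩
  rw [symCubeRep_toHom, ht]
  ext i j
  fin_cases i <;> fin_cases j <;>
    simp [symCube, charEval_add, charEval_zsmul, hz, -zsmul_eq_mul]

theorem symCubeRep_hasHighestWeight {θ : H0 g k̄ Φ →* Matrix (Fin 2) (Fin 2) k̄}
    {hθ : HasRegularEntries (k := k) θ}
    {Δ : Set (X g)} {χ₁ χ₂ : X g}
    (ht : ∀ t : TorusPt g k̄, θ ⟨torusElt t, torusElt_mem Φ t⟩ =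
      Matrix.diagonal ![(charEval χ₁ t : k̄), (charEval χ₂ t : k̄)])
    (hΔ : ∀ α ∈ Φ, α ∈ AddSubmonoid.closure Δ → ∀ h : H0 g k̄ Φ,
      IsRootElt α (h : (Cl g k̄)ˣ) → ∃ s, θ h = !![1, s; 0, 1]) :
    (symCubeRep (k := k) θ hθ).HasHighestWeight Δ ((3 : ℤ) • χ₁) := by
  refine ⟨Pi.single 0 1, by simp, fun t => ?_, fun α hα hαΔ h hh => ?_⟩
  · rw [symCubeRep_torus ht]
    ext i
    fin_cases i <;> simp
  · obtain ⟨s, hs⟩ := hΔ α hα hαΔ h hh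
    rw [symCubeRep_toHom, hs, symCube_apply]
    ext i
    fin_cases i <;> simp

theorem symCubeRep_weights {θ : H0 g k̄ Φ →* Matrix (Fin 2) (Fin 2) k̄}
    {hθ : HasRegularEntries (k := k) θ}
    {χ₁ χ₂ : X g}
    (ht : ∀ t : TorusPt g k̄, θ ⟨torusElt t, torusElt_mem Φ t⟩ =
      Matrix.diagonal ![(charEval χ₁ t : k̄), (charEval χ₂ t : k̄)]) {χ : X g}
    (hχ : χ ∈ (symCubeRep (k := k) θ hθ).weights) :
    ∃ i, χ = ![(3 : ℤ) • χ₁, (2 : ℤ) • χ₁ + χ₂, χ₁ + (2 : ℤ) • χ₂, (3 : ℤ) • χ₂] i := by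
  obtain ⟨x, hx0, hx⟩ := hχ
  obtain ⟨i, hi⟩ := Function.ne_iff.1 hx0
  refine ⟨i, eq_of_charEval_eq (K := k̄) fun t => Units.ext ?_⟩
  have h := congrFun (hx t) i
  rw [symCubeRep_torus ht, Matrix.mulVec_diagonal, Pi.smul_apply, smul_eq_mul] at h
  exact (mul_right_cancel₀ hi h).symm

end SymCubeRep
end SpinLemma

namespace SpinLemma
open CliffordAlgebra

/-! ### The long roots for `g = 2` and their two bases -/

section LongRoots

theorem mem_roots_of_mem_longRoots {α : X 2} (hα : α ∈ longRoots) : α ∈ roots 2 := by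
  rcases hα with rfl | rfl | rfl | rfl
  · exact ⟨.inl (.inl 0), .inl (.inl 1), by simp, by decide, by decide⟩
  · exact ⟨.inl (.inl 0), .inl (.inr 1), by simp, by decide, by decide⟩
  · exact ⟨.inl (.inr 0), .inl (.inl 1), by simp, by decide, by decide⟩
  · exact ⟨.inl (.inr 0), .inl (.inr 1), by simp, by decide, by decide⟩

theorem sum_sq_of_mem_roots {g : ℕ} {β : X g} (hβ : β ∈ roots g) :
    ∑ i, β.1 i ^ 2 = 1 ∨ ∑ i, β.1 i ^ 2 = 2 := by
  rcases root_cases hβ with ⟨j, k, hjk, h0, rfl⟩ | ⟨j, rfl⟩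
  · exact Or.inr (sum_root_sq j k hjk h0)
  · exact Or.inl (sum_wt_sq j)

theorem linearIndepOn_pair_of_det {a b c d : ℤ} (h : a * d - b * c ≠ 0) :
    LinearIndepOn ℤ id ({(![a, b], 0), (![c, d], 0)} : Set (X 2)) := by
  have hne : ((![a, b], 0) : X 2) ≠ (![c, d], 0) := fun he => h (by
    have h1 := congrFun (congrArg Prod.fst he) 0
    have h2 := congrFun (congrArg Prod.fst he) 1
    simp at h1 h2
    rw [h1, h2]; ring)
  rw [LinearIndepOn.pair_iff _ hne]
  intro s t hst
  have h1 := congrFun (congrArg Prod.fst hst) 0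
  have h2 := congrFun (congrArg Prod.fst hst) 1
  simp at h1 h2
  constructor
  · have : s * (a * d - b * c) = 0 := by linear_combination d * h1 - c * h2
    exact (mul_eq_zero.1 this).resolve_right h
  · have : t * (a * d - b * c) = 0 := by linear_combination a * h2 - b * h1
    exact (mul_eq_zero.1 this).resolve_right h

theorem finrank_span_longRoots : Module.finrank ℤ (Submodule.span ℤ longRoots) = 2 := by
  have h1 : ({(![1, 1], 0), (![1, -1], 0)} : Set (X 2)) ⊆ longRoots := by
    rintro α (rfl | rfl)
    · exact Or.inl rfl
    · exact Or.inr (Or.inl rfl)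
  have hs : Submodule.span ℤ longRoots =
      Submodule.span ℤ ({(![1, 1], 0), (![1, -1], 0)} : Set (X 2)) := by
    refine le_antisymm (Submodule.span_le.2 ?_) (Submodule.span_mono h1)
    have m1 := Submodule.subset_span (R := ℤ)
      (Set.mem_insert ((![1, 1], 0) : X 2) {(![1, -1], 0)})
    have m2 := Submodule.subset_span (R := ℤ)
      (Set.mem_insert_of_mem ((![1, 1], 0) : X 2) (Set.mem_singleton ((![1, -1], 0) : X 2)))
    rintro α (rfl | rfl | rfl | rfl)
    · exact m1
    · exact m2
    · have := Submodule.neg_mem _ m2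
      simpa using this
    · have := Submodule.neg_mem _ m1
      simpa using this
  have hli : LinearIndepOn ℤ id ({(![1, 1], 0), (![1, -1], 0)} : Set (X 2)) :=
    linearIndepOn_pair_of_det (by norm_num)
  rw [hs, finrank_span_set_eq_card hli]
  rw [← Set.ncard_eq_toFinset_card', Set.ncard_pair (by simp)]

theorem isSubsystem_longRoots : IsSubsystem longRoots where
  subset _ := mem_roots_of_mem_longRoots
  neg_mem := by
    rintro α (rfl | rfl | rfl | rfl) <;> simp [longRoots]
  add_mem := by
    intro α hα β hβ h
    exfalso
    -- A sum of two long roots has square length `0`, `4` or `8`, so it is never a root.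
    have := sum_sq_of_mem_roots h
    rcases hα with rfl | rfl | rfl | rfl <;> rcases hβ with rfl | rfl | rfl | rfl <;>
      simp [Fin.sum_univ_two] at this
  signAct_mem := by
    rintro B α (rfl | rfl | rfl | rfl) <;> by_cases h0 : 0 ∈ B <;> by_cases h1 : 1 ∈ B <;>
      simp [longRoots, signAct, funext_iff, h0, h1]
  rank := finrank_span_longRoots

theorem isBase_longRoots_standard :
    IsBase longRoots {(![1, 1], 0), (![1, -1], 0)} where
  subset := by
    rintro α (rfl | rfl)
    · exact Or.inl rfl
    · exact Or.inr (Or.inl rfl)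
  indep := linearIndepOn_pair_of_det (by norm_num)
  pos_or_neg := by
    rintro α (rfl | rfl | rfl | rfl)
    · exact Or.inl (AddSubmonoid.subset_closure (Or.inl rfl))
    · exact Or.inl (AddSubmonoid.subset_closure (Or.inr rfl))
    · exact Or.inr (AddSubmonoid.subset_closure (Or.inr (by simp)))
    · exact Or.inr (AddSubmonoid.subset_closure (Or.inl (by simp)))

theorem isBase_longRoots_negative :
    IsBase longRoots {(![-1, -1], 0), (![1, -1], 0)} where
  subset := by
    rintro α (rfl | rfl)
    · exact Or.inr (Or.inr (Or.inr rfl))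
    · exact Or.inr (Or.inl rfl)
  indep := linearIndepOn_pair_of_det (by norm_num)
  pos_or_neg := by
    rintro α (rfl | rfl | rfl | rfl)
    · exact Or.inr (AddSubmonoid.subset_closure (Or.inl (by simp)))
    · exact Or.inl (AddSubmonoid.subset_closure (Or.inr rfl))
    · exact Or.inr (AddSubmonoid.subset_closure (Or.inr (by simp)))
    · exact Or.inl (AddSubmonoid.subset_closure (Or.inl rfl))

theorem positive_standard {α : X 2} (hα : α ∈ longRoots)
    (h : α ∈ AddSubmonoid.closure ({(![1, 1], 0), (![1, -1], 0)} : Set (X 2))) :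
    α = (![1, 1], 0) ∨ α = (![1, -1], 0) := by
  -- The first coordinate is nonnegative on this basis and negative on the other two roots. For the
  -- other basis the second coordinate plays this role.
  have h0 : 0 ≤ α.1 0 := by
    clear hα
    induction h using AddSubmonoid.closure_induction with
    | mem x hx => rcases hx with rfl | rfl <;> simp
    | zero => simp
    | add x y _ _ hx hy => exact add_nonneg hx hy
  rcases hα with rfl | rfl | rfl | rfl
  · exact Or.inl rfl
  · exact Or.inr rfl
  · norm_num at h0
  · norm_num at h0

theorem positive_negative {α : X 2} (hα : α ∈ longRoots)
    (h : α ∈ AddSubmonoid.closure ({(![-1, -1], 0), (![1, -1], 0)} : Set (X 2))) :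
    α = (![-1, -1], 0) ∨ α = (![1, -1], 0) := by
  have h0 : α.1 1 ≤ 0 := by
    clear hα
    induction h using AddSubmonoid.closure_induction with
    | mem x hx => rcases hx with rfl | rfl <;> simp
    | zero => simp
    | add x y _ _ hx hy => exact add_nonpos hx hy
  rcases hα with rfl | rfl | rfl | rfl
  · norm_num at h0
  · exact Or.inr rfl
  · norm_num at h0
  · exact Or.inl rfl

end LongRoots

/-! ### Two explicit weight vectors of the spin representation -/

section SpinWeightVectors

variable {g : ℕ} {k : Type*} [Field k]

theorem spinRep_bvec_inr_one {K : Type*} [Field K] (i : Fin g) :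
    spinRep g K (bvec g K (.inl (.inr i))) 1 = 0 := by
  rw [spinRep, bvec, lift_ι_apply, spinVec_apply]
  have h : ExteriorAlgebra.ι K (fun j : Fin g => (Pi.single (.inl (.inr i)) 1 : Idx g → K)
      (.inl (.inl j))) = 0 := by
    rw [show (fun j : Fin g => (Pi.single (.inl (.inr i)) 1 : Idx g → K) (.inl (.inl j))) = 0 from
      funext fun j => by simp, map_zero]
  rw [h]
  simp [contractLeft_one]

/-- A vector on which every `e_i e'_i` acts as `2` or `0` is a weight vector. -/
theorem mem_spinWeights_of_eigenvector {y : ExteriorAlgebra (AlgebraicClosure k)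
      (Fin g → AlgebraicClosure k)} (hy : y ≠ 0) (m : Fin g → ℤ)
    (h : ∀ (i : Fin g) (a : (AlgebraicClosure k)ˣ),
      spinRep g (AlgebraicClosure k) (torusFactor g _ i a : Cl g _) y =
        ((a ^ m i : (AlgebraicClosure k)ˣ) : AlgebraicClosure k) • y) :
    (m, 1) ∈ spinWeights g k := by
  refine ⟨y, hy, fun t => ?_⟩
  have key : ∀ L : List (Fin g), spinRep g (AlgebraicClosure k)
      (((L.map fun i => torusFactor g _ i (t.1 i)).prod : (Cl g (AlgebraicClosure k))ˣ) : Cl g _) y =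
      (((L.map fun i => t.1 i ^ m i).prod : (AlgebraicClosure k)ˣ) : AlgebraicClosure k) • y := by
    intro L
    induction L with
    | nil => simp
    | cons i L ih =>
      rw [List.map_cons, List.prod_cons, Units.val_mul, map_mul, Module.End.mul_apply, ih,
        map_smul, h, List.map_cons, List.prod_cons, Units.val_mul, smul_smul, mul_comm]
  rw [torusElt, Units.val_mul, List.ofFn_eq_map, map_mul, Module.End.mul_apply, key, charEval,
    ← List.prod_ofFn, List.ofFn_eq_map, zpow_one, Units.val_mul, mul_comm, mul_smul]
  exact (congrFun (congrArg DFunLike.coe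
    ((spinRep g (AlgebraicClosure k)).commutes (t.2 : AlgebraicClosure k))) _)

/-- The vector `1` is killed by every `e'_i`, so only the scalar part of the torus moves it. -/
theorem zero_one_mem_spinWeights : ((0, 1) : X g) ∈ spinWeights g k := by
  refine mem_spinWeights_of_eigenvector (y := 1) one_ne_zero 0 fun i a => ?_
  rw [torusFactor, map_add, map_one (spinRep g _), map_smul, map_mul, LinearMap.add_apply, LinearMap.smul_apply,
    Module.End.mul_apply, spinRep_bvec_inr_one]
  simp

/-- The vector is `e_1 e_2`. Every `e_i` kills it, so `e_i e'_i = 2 - e'_i e_i` acts on it as `2`.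
It is nonzero because contraction with `e'_1` and then `e'_2` returns `4`. -/
theorem minuscule_mem_spinWeights (h2 : (2 : k) ≠ 0) : minuscule 2 ∈ spinWeights 2 k := by
  set K := AlgebraicClosure k
  have h2' : (2 : K) ≠ 0 := fun h => h2 ((algebraMap k K).injective (by
    rw [map_ofNat, map_zero, h]))
  set R := spinRep 2 K
  set e : Fin 2 → Cl 2 K := fun i => bvec 2 K (.inl (.inl i)) with he
  set f : Fin 2 → Cl 2 K := fun i => bvec 2 K (.inl (.inr i)) with hf
  have hef : ∀ i, e i * f i + f i * e i = 2 := fun i => bvec_mul_dual_add (.inl (.inl i))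
  have hee : ∀ i, e i * e i = 0 := bvec_sq_left 2 K
  have hanti : e 1 * e 0 = -(e 0 * e 1) := bvec_mul_bvec_swap _ _ (by simp [dualIdx])
  have hfe : f 0 * e 1 = -(e 1 * f 0) := bvec_mul_bvec_swap _ _ (by simp [dualIdx])
  have hf1 : ∀ i, R (f i) 1 = 0 := fun i => spinRep_bvec_inr_one i
  have hR2 : R 2 = (2 : K) • 1 := by
    rw [map_ofNat, two_smul, one_add_one_eq_two]
  set y := R (e 0 * e 1) 1 with hy
  have habs : ∀ i, R (e i) y = 0 := fun i => by
    rw [hy, ← Module.End.mul_apply, ← map_mul]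
    fin_cases i
    · change R (e 0 * (e 0 * e 1)) 1 = 0
      rw [← mul_assoc, hee]; simp
    · change R (e 1 * (e 0 * e 1)) 1 = 0
      rw [← mul_assoc, hanti, neg_mul, mul_assoc, hee]; simp
  have hy0 : y ≠ 0 := by
    intro h0
    have e1 : R (f 0) y = (2 : K) • R (e 1) 1 := by
      rw [hy, ← Module.End.mul_apply, ← map_mul, ← mul_assoc,
        show f 0 * e 0 = 2 - e 0 * f 0 by rw [← hef 0]; abel, sub_mul, mul_assoc, hfe, map_sub,
        map_mul, hR2]
      simp [hf1]
    have e2 : R (f 1) (R (e 1) 1) = (2 : K) • 1 := by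
      rw [← Module.End.mul_apply, ← map_mul,
        show f 1 * e 1 = 2 - e 1 * f 1 by rw [← hef 1]; abel, map_sub, hR2]
      simp [hf1]
    rw [h0, map_zero] at e1
    have e3 : R (e 1) 1 = 0 := (smul_eq_zero.1 e1.symm).resolve_left h2'
    rw [e3, map_zero] at e2
    exact one_ne_zero ((smul_eq_zero.1 e2.symm).resolve_left h2')
  refine mem_spinWeights_of_eigenvector hy0 (fun _ => 1) fun i a => ?_
  have hact : R (e i * f i) y = (2 : K) • y := by
    rw [show e i * f i = 2 - f i * e i by rw [← hef i]; abel, map_sub, hR2, map_mul]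
    simp [habs]
  have : R (torusFactor 2 K i a : Cl 2 K) y = y + (((a : K) - 1) / 2) • R (e i * f i) y := by
    rw [torusFactor, map_add, map_one, map_smul]; rfl
  change R (torusFactor 2 K i a : Cl 2 K) y = _
  rw [this, hact, smul_smul, div_mul_cancel₀ _ h2', zpow_one]
  module

end SpinWeightVectors

/-! ### The representations for `p = 5` -/

section Examples

variable {k : Type*} [Field k]

/-- Fourth powers are trivial in `k^×`. On admissible points `ν` takes `w`-th powers as values, so
`cν` is trivial as soon as `4 ∣ wc`. -/
theorem SameRestriction.of_sub_eq [Finite k] (hk : Nat.card k = 5) {g w : ℕ} {χ η ψ : X g} {c : ℤ}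
    (hc : (4 : ℤ) ∣ w * c) (h : χ - η = c • nu g + (4 : ℤ) • ψ) : SameRestriction k w χ η := by
  rintro t ⟨y, hy⟩
  have h4 : ∀ u : kˣ, u ^ (4 : ℤ) = 1 := fun u => by
    have : u ^ Nat.card kˣ = 1 := pow_card_eq_one'
    rw [Nat.card_units, hk] at this
    exact this
  obtain ⟨d, hd⟩ := hc
  have h1 : charEval (χ - η) t = 1 := by
    rw [h, charEval_add, charEval_zsmul, charEval_zsmul, h4, mul_one, hy, ← zpow_natCast, ← zpow_mul,
      hd, zpow_mul, h4, one_zpow]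
  rwa [charEval_sub, div_eq_one] at h1

theorem isReduced_smul_minuscule {w : ℕ} (c : ℤ) {Δ : Set (X 2)}
    (h : ∀ β ∈ Δ, 0 ≤ pair (c • minuscule 2) β ∧ pair (c • minuscule 2) β ≤ 4) :
    IsReduced 5 w Δ (c • minuscule 2) := by
  have hm : minuscule 2 ∈ AddSubgroup.closure (Set.range (fundWeight 2)) :=
    AddSubgroup.subset_closure ⟨1, by simp [fundWeight]⟩
  refine ⟨c • minuscule 2, 0, zsmul_mem hm c, ?_, by simp, fun β hβ => ⟨(h β hβ).1, (h β hβ).2.trans (by norm_num)⟩⟩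
  exact Nat.div_pos (Nat.le_of_dvd (by norm_num) (Nat.gcd_dvd_right _ _))
    (Nat.gcd_pos_of_pos_right _ (by norm_num))

local notation "k̄" => AlgebraicClosure k

theorem exists_ratRep_standard (h2 : (2 : k) ≠ 0) (h3 : (3 : k) ≠ 0) :
    ∃ W : RatRep 2 k longRoots 4, W.IsSimple ∧
      W.HasHighestWeight {(![1, 1], 0), (![1, -1], 0)} ((3 : ℤ) • minuscule 2) ∧
      ∀ χ ∈ W.weights, ∃ i, χ = ![(3 : ℤ) • minuscule 2, (2 : ℤ) • minuscule 2 + (0, 1),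
        minuscule 2 + (2 : ℤ) • (0, 1), (3 : ℤ) • (0, 1)] i := by
  have h2' : (2 : k̄) ≠ 0 := fun h => h2 ((algebraMap k k̄).injective (by
    rw [map_ofNat, map_zero, h]))
  have hreg : HasRegularEntries (k := k) (evenHom (K := k̄) h2') := fun i j =>
    ⟨_, (evenBlock_mem_regularFunctions k i j).1, fun _ => rfl⟩
  have ht : ∀ t : TorusPt 2 k̄, evenHom h2' ⟨torusElt t, torusElt_mem longRoots t⟩ =
      Matrix.diagonal ![(charEval (minuscule 2) t : k̄), (charEval ((0, 1) : X 2) t : k̄)] :=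
    evenBlock_torusElt h2'
  refine ⟨symCubeRep (evenHom h2') hreg, symCubeRep_isSimple h2 h3 exists_mem_H0_upper
    (exists_mem_H0_lower h2'), symCubeRep_hasHighestWeight ht ?_,
    fun χ hχ => symCubeRep_weights ht hχ⟩
  intro α hα hαΔ h hh
  rcases positive_standard hα hαΔ with rfl | rfl
  · exact exists_evenBlock_eq_upper hh
  · exact ⟨0, (evenBlock_eq_one hh).trans Matrix.one_fin_two⟩

/-- The dual of the representation `evenHom`. -/
def evenDualHom {K : Type*} [Field K] (h2 : (2 : K) ≠ 0) :
    H0 2 K longRoots →* Matrix (Fin 2) (Fin 2) K where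
  toFun h := (evenHom h2 h⁻¹).transpose
  map_one' := by rw [inv_one, map_one, Matrix.transpose_one]
  map_mul' h h' := by rw [mul_inv_rev, map_mul, Matrix.transpose_mul]

theorem evenDualHom_eq_of_mul_eq_one {K : Type*} [Field K] (h2 : (2 : K) ≠ 0)
    {h : H0 2 K longRoots} {M : Matrix (Fin 2) (Fin 2) K} (hM : evenHom h2 h * M = 1) :
    evenDualHom h2 h = M.transpose := by
  have h1 : evenHom h2 h⁻¹ * evenHom h2 h = 1 := by rw [← map_mul, inv_mul_cancel, map_one]
  change (evenHom h2 h⁻¹).transpose = _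
  rw [left_inv_eq_right_inv h1 hM]

/-- Dualizing makes the root subgroup of `-ε_1 - ε_2` upper triangular, so `-ϖ̂` becomes the highest
weight for the basis containing that root. -/
theorem exists_ratRep_dual (h2 : (2 : k) ≠ 0) (h3 : (3 : k) ≠ 0) :
    ∃ W : RatRep 2 k longRoots 4, W.IsSimple ∧
      W.HasHighestWeight {(![-1, -1], 0), (![1, -1], 0)} ((3 : ℤ) • -minuscule 2) ∧
      ∀ χ ∈ W.weights, ∃ i, χ = ![(3 : ℤ) • -minuscule 2, (2 : ℤ) • -minuscule 2 + -(0, 1),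
        -minuscule 2 + (2 : ℤ) • -(0, 1), (3 : ℤ) • -(0, 1)] i := by
  have h2' : (2 : k̄) ≠ 0 := fun h => h2 ((algebraMap k k̄).injective (by
    rw [map_ofNat, map_zero, h]))
  have hreg : HasRegularEntries (k := k) (evenDualHom (K := k̄) h2') := fun i j =>
    ⟨_, (evenBlock_mem_regularFunctions k j i).2, fun _ => rfl⟩
  have hlow : ∀ (h : H0 2 k̄ longRoots) (s : k̄), evenHom h2' h = !![1, 0; s, 1] →
      evenDualHom h2' h = !![1, -s; 0, 1] := fun h s hs => by
    rw [evenDualHom_eq_of_mul_eq_one h2' (M := !![1, 0; -s, 1])]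
    · ext i j; fin_cases i <;> fin_cases j <;> simp
    · rw [hs, Matrix.one_fin_two]
      ext i j; fin_cases i <;> fin_cases j <;> simp [Matrix.mul_apply, Fin.sum_univ_two]
  have hupp : ∀ (h : H0 2 k̄ longRoots) (s : k̄), evenHom h2' h = !![1, s; 0, 1] →
      evenDualHom h2' h = !![1, 0; -s, 1] := fun h s hs => by
    rw [evenDualHom_eq_of_mul_eq_one h2' (M := !![1, -s; 0, 1])]
    · ext i j; fin_cases i <;> fin_cases j <;> simp
    · rw [hs, Matrix.one_fin_two]
      ext i j; fin_cases i <;> fin_cases j <;> simp [Matrix.mul_apply, Fin.sum_univ_two]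
  have ht : ∀ t : TorusPt 2 k̄, evenDualHom h2' ⟨torusElt t, torusElt_mem longRoots t⟩ =
      Matrix.diagonal ![(charEval (-minuscule 2) t : k̄), (charEval (-(0, 1) : X 2) t : k̄)] := by
    intro t
    rw [evenDualHom_eq_of_mul_eq_one h2' (M := Matrix.diagonal ![(charEval (-minuscule 2) t : k̄),
      (charEval (-(0, 1) : X 2) t : k̄)]), Matrix.diagonal_transpose]
    have : evenHom h2' ⟨torusElt t, torusElt_mem longRoots t⟩ = _ := evenBlock_torusElt h2' t
    rw [this, Matrix.diagonal_mul_diagonal, ← Matrix.diagonal_one]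
    congr 1
    funext i
    fin_cases i <;> simp only [charEval_neg] <;> simp
  refine ⟨symCubeRep (evenDualHom h2') hreg, symCubeRep_isSimple h2 h3 (fun s => ?_)
    (fun s => ?_), symCubeRep_hasHighestWeight ht ?_, fun χ hχ => symCubeRep_weights ht hχ⟩
  · obtain ⟨h, hh⟩ := exists_mem_H0_lower h2' (-s)
    exact ⟨h, by rw [hlow h _ hh, neg_neg]⟩
  · obtain ⟨h, hh⟩ := exists_mem_H0_upper (-s)
    exact ⟨h, by rw [hupp h _ hh, neg_neg]⟩
  · intro α hα hαΔ h hh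
    rcases positive_negative hα hαΔ with rfl | rfl
    · obtain ⟨s, hs⟩ := exists_evenBlock_eq_lower hh
      exact ⟨_, hlow h s hs⟩
    · refine ⟨_, hlow h 0 ((evenBlock_eq_one hh).trans Matrix.one_fin_two)⟩

end Examples
end SpinLemma

namespace SpinLemma

/-! ### The two counterexamples -/

section Examples

variable {k : Type*} [Field k]

theorem cast_ne_zero_of_charP_five [CharP k 5] : (2 : k) ≠ 0 ∧ (3 : k) ≠ 0 := by
  constructor
  · intro h
    have : ((2 : ℕ) : k) = 0 := by exact_mod_cast h
    rw [CharP.cast_eq_zero_iff k 5] at this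
    omega
  · intro h
    have : ((3 : ℕ) : k) = 0 := by exact_mod_cast h
    rw [CharP.cast_eq_zero_iff k 5] at this
    omega

theorem exists_counterexample_negative [Finite k] [CharP k 5] {w : ℕ} (hk : Nat.card k = 5)
    (hw : Even w) :
    IsReduced (Nat.card k) w {(![-1, -1], 0), (![1, -1], 0)} ((-3 : ℤ) • minuscule 2) ∧
    ∃ (n : ℕ) (W : RatRep 2 k longRoots n), W.IsSimple ∧
      W.HasHighestWeight {(![-1, -1], 0), (![1, -1], 0)} ((-3 : ℤ) • minuscule 2) ∧
      SameRestriction k w ((-3 : ℤ) • minuscule 2) (minuscule 2) ∧ WeightsInSpin w W := by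
  obtain ⟨h2, h3⟩ := cast_ne_zero_of_charP_five (k := k)
  -- With `η = ν - ϖ̂`, the two middle weights of the dual cube are `η - 2ν` and `ϖ̂ - 2ν`; for even
  -- `w` the term `2ν` is trivial. The outer ones are `ϖ̂ - 4ϖ̂` and `η - 4η`.
  have hw2 : (4 : ℤ) ∣ w * (-2) := by
    obtain ⟨r, rfl⟩ := hw
    exact ⟨-r, by push_cast; ring⟩
  have hmin : SameRestriction k w ((-3 : ℤ) • minuscule 2) (minuscule 2) :=
    SameRestriction.of_sub_eq hk (c := 0) (ψ := -minuscule 2) (by simp) (by module)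
  refine ⟨?_, ?_⟩
  · rw [hk]
    refine isReduced_smul_minuscule _ ?_
    rintro β (rfl | rfl) <;> simp [pair, minuscule, Fin.sum_univ_two] <;> norm_num
  · obtain ⟨W, hs, hh, hχ⟩ := exists_ratRep_dual h2 h3
    have he : (3 : ℤ) • -minuscule 2 = (-3 : ℤ) • minuscule 2 := by module
    rw [he] at hh
    refine ⟨4, W, hs, hh, hmin, fun χ hχW => ?_⟩
    obtain ⟨i, rfl⟩ := hχ χ hχW
    fin_cases i
    · exact ⟨_, minuscule_mem_spinWeights h2, show SameRestriction k w ((3 : ℤ) • -minuscule 2) _ from he ▸ hmin⟩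
    · exact ⟨_, zero_one_mem_spinWeights,
        SameRestriction.of_sub_eq hk (c := -2) (ψ := 0) hw2 (by decide)⟩
    · exact ⟨_, minuscule_mem_spinWeights h2,
        SameRestriction.of_sub_eq hk (c := -2) (ψ := 0) hw2 (by decide)⟩
    · exact ⟨_, zero_one_mem_spinWeights,
        SameRestriction.of_sub_eq hk (c := 0) (ψ := (0, -1)) (by simp) (by decide)⟩

theorem exists_counterexample_standard [Finite k] [CharP k 5] {w : ℕ} (hk : Nat.card k = 5)
    (hw : 4 ∣ w) :
    IsReduced (Nat.card k) w {(![1, 1], 0), (![1, -1], 0)} ((3 : ℤ) • minuscule 2) ∧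
    ∃ (n : ℕ) (W : RatRep 2 k longRoots n), W.IsSimple ∧
      W.HasHighestWeight {(![1, 1], 0), (![1, -1], 0)} ((3 : ℤ) • minuscule 2) ∧
      SameRestriction k w ((3 : ℤ) • minuscule 2) (signAct Finset.univ (minuscule 2)) ∧
      WeightsInSpin w W := by
  obtain ⟨h2, h3⟩ := cast_ne_zero_of_charP_five (k := k)
  have hw4 : ∀ c : ℤ, (4 : ℤ) ∣ w * c := fun c => by
    obtain ⟨r, rfl⟩ := hw
    exact ⟨r * c, by push_cast; ring⟩
  refine ⟨?_, ?_⟩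
  · rw [hk]
    refine isReduced_smul_minuscule _ ?_
    rintro β (rfl | rfl) <;> simp [pair, minuscule, Fin.sum_univ_two] <;> norm_num
  · obtain ⟨W, hs, hh, hχ⟩ := exists_ratRep_standard h2 h3
    -- With `η = w_{\{1,2\}} ϖ̂ = ν - ϖ̂`, one has `3ϖ̂ = η + 3ν - 4η`.
    refine ⟨4, W, hs, hh, SameRestriction.of_sub_eq hk (c := 3) (ψ := (0, -1)) (hw4 _) (by decide),
      fun χ hχW => ?_⟩
    obtain ⟨i, rfl⟩ := hχ χ hχW
    fin_cases i
    · exact ⟨_, zero_one_mem_spinWeights,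
        SameRestriction.of_sub_eq hk (c := 3) (ψ := (0, -1)) (hw4 _) (by decide)⟩
    · exact ⟨_, minuscule_mem_spinWeights h2,
        SameRestriction.of_sub_eq hk (c := 1) (ψ := 0) (hw4 _) (by decide)⟩
    · exact ⟨_, zero_one_mem_spinWeights,
        SameRestriction.of_sub_eq hk (c := 1) (ψ := 0) (hw4 _) (by decide)⟩
    · exact ⟨_, minuscule_mem_spinWeights h2,
        SameRestriction.of_sub_eq hk (c := -1) (ψ := (0, 1)) (hw4 _) (by decide)⟩

end Examples
end SpinLemma

theorem mainTheorem5 :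
    -- the case `p > 5`
    (∀ (g : ℕ), 1 ≤ g → ∀ (p : ℕ), p.Prime → 5 < p →
      ∀ (k : Type*) [Field k] [Finite k] [CharP k p] (w : ℕ) (Φ Δ : Set (SpinLemma.X g)),
        SpinLemma.IsSubsystem Φ → SpinLemma.IsBase Φ Δ →
        ∀ μ : SpinLemma.X g, SpinLemma.IsReduced (Nat.card k) w Δ μ →
        ∀ (n : ℕ) (W : SpinLemma.RatRep g k Φ n),
          W.IsSimple → W.HasHighestWeight Δ μ →
          SpinLemma.SameRestriction k w μ (SpinLemma.minuscule g) →
          SpinLemma.WeightsInSpin w W →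
          μ = SpinLemma.minuscule g) ∧
    -- for `p = 5` the same assertion fails, for `g = 2`, `H⁰ ∩ Spin_5 = SL_2 × SL_2`, the basis
    -- `-ε_1 - ε_2, ε_1 - ε_2` and `μ = -3 ϖ̂`
    (SpinLemma.IsSubsystem SpinLemma.longRoots ∧
      SpinLemma.IsBase SpinLemma.longRoots {(![-1, -1], 0), (![1, -1], 0)} ∧
      (-3 : ℤ) • SpinLemma.minuscule 2 ≠ SpinLemma.minuscule 2 ∧
      ∀ (k : Type*) [Field k] [Finite k] [CharP k 5] (w : ℕ), Nat.card k = 5 → Even w →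
        SpinLemma.IsReduced (Nat.card k) w {(![-1, -1], 0), (![1, -1], 0)}
          ((-3 : ℤ) • SpinLemma.minuscule 2) ∧
        ∃ (n : ℕ) (W : SpinLemma.RatRep 2 k SpinLemma.longRoots n),
          W.IsSimple ∧
          W.HasHighestWeight {(![-1, -1], 0), (![1, -1], 0)} ((-3 : ℤ) • SpinLemma.minuscule 2) ∧
          SpinLemma.SameRestriction k w ((-3 : ℤ) • SpinLemma.minuscule 2)
            (SpinLemma.minuscule 2) ∧
          SpinLemma.WeightsInSpin w W) ∧
    -- the form with `μ = 3 ϖ̂` for `p = 5`, trivial multiplier and the standard Borel subgroup: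
    -- there `μ` restricts like a `W'`-conjugate of `ϖ̂` without being one
    (SpinLemma.IsBase SpinLemma.longRoots {(![1, 1], 0), (![1, -1], 0)} ∧
      (∀ B : Finset (Fin 2),
        (3 : ℤ) • SpinLemma.minuscule 2 ≠ SpinLemma.signAct B (SpinLemma.minuscule 2)) ∧
      ∀ (k : Type*) [Field k] [Finite k] [CharP k 5] (w : ℕ), Nat.card k = 5 → 4 ∣ w →
        SpinLemma.IsReduced (Nat.card k) w {(![1, 1], 0), (![1, -1], 0)}
          ((3 : ℤ) • SpinLemma.minuscule 2) ∧
        ∃ (n : ℕ) (W : SpinLemma.RatRep 2 k SpinLemma.longRoots n),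
          W.IsSimple ∧
          W.HasHighestWeight {(![1, 1], 0), (![1, -1], 0)} ((3 : ℤ) • SpinLemma.minuscule 2) ∧
          SpinLemma.SameRestriction k w ((3 : ℤ) • SpinLemma.minuscule 2)
            (SpinLemma.signAct Finset.univ (SpinLemma.minuscule 2)) ∧
          SpinLemma.WeightsInSpin w W) := by
  refine ⟨fun g hg p hp hp5 k _ _ _ w Φ Δ hΦ hΔ μ hμ n W _ hW hres hwt =>
    SpinLemma.eq_minuscule_of_isReduced hg hp hp5 hΦ hΔ hμ W hW hres hwt,
    ⟨SpinLemma.isSubsystem_longRoots, SpinLemma.isBase_longRoots_negative, by decide,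
      fun k _ _ _ w hk hw => SpinLemma.exists_counterexample_negative hk hw⟩,
    SpinLemma.isBase_longRoots_standard, by decide,
    fun k _ _ _ w hk hw => SpinLemma.exists_counterexample_standard hk hw⟩
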